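/- Let $n\ge 2$. Let $\mathcal S^n_0$ be the space of real symmetric trace-free $n\times n$ matrices, $F(u)=u\otimes u-\frac{|u|^2}{n}I_n$ for $u\in\mathbb R^n$, and let $\mathfrak K$ be the set of compact convex subsets of $\mathbb R^n$ containing a neighbourhood of $0$, with the Hausdorff distance. For $\mathcal K\in\mathfrak K$ let $j_{\mathcal K}(x)=\inf\{s>0:\ x\in s\mathcal K\}$ be its gauge, let $r_{\min}(\mathcal K)=\sup\{R\ge0: B(0,R)\subset\mathcal K\}$ and $r_{\max}(\mathcal K)=\inf\{R>0:\mathcal K\subset B(0,R)\}$ (closed balls), and call $\mathcal K$ $c$-uniformly convex if $j_{\mathcal K}(x+y)^2+j_{\mathcal K}(x-y)^2\ge 2j_{\mathcal K}(x)^2+c\,j_{\mathcal K}(y)^2$ for all $x,y\in\mathbb R^n$. For $z_0=(v_0,M_0,q_0)\in\mathbb R^n\times\mathcal S^n_0\times\mathbb R$ and $r>0$ let $$\Lambda_{\mathcal K}(z_0,r)=\Big\{s\Big(b-a,\,F(b)-F(a),\,\tfrac{|b|^2-|a|^2}{n}\Big):\ s\ge 0,\ a,b\in v_0+r\,\partial\mathcal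 K,\ |a|^2|b|^2\ne(a\cdot b)^2\Big\}.$$ Let $O\subset\mathbb R^n$ be a bounded non-empty open set, $I=(t_0,t_1)$ a bounded interval, $\theta\in(0,\frac{t_1-t_0}{2})$ and $I_\theta=[t_0+\theta,t_1-\theta]$. Let $O'$ be a non-empty open set with $\overline{O'}\subset O$. Let $\mathcal K\in\mathfrak K$, $z_0\in\mathbb R^n\times\mathcal S^n_0\times\mathbb R$, $r>0$, $\lambda=(\bar v,\bar M,\bar q)\in\Lambda_{\mathcal K}(z_0,r)$, and let $\mathcal V\subset\mathbb R^n\times\mathcal S^n_0\times\mathbb R$ be a neighbourhood of the segment $[-\lambda,\lambda]$. Let $\mathbf K:\bar I\times\bar O\to\mathfrak K$ and $u:\bar I\times\bar O\to\mathbb R^n$ be continuous, and assume that there are $c_0>0$ and $R_0>r_0>0$ such that, for every $(t,x)\in\bar I\times\bar O$, the set $\mathbf K(t,x)$ is $c_0$-uniformly convex, $r_{\min}(\mathbf K(t,x))\ge r_0$ and $r_{\max}(\mathbf K(t,x))\le R_0$. Then for every $\eta>0$ there exists $z=(v,M,q)\in C^\infty_c(I\times O;\mathcal V)$ such that 1.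 $\partial_t v+\nabla_x\cdot M+\nabla_x q=0$ and $\nabla_x\cdot v=0$; 2. for every $t\in I_\theta$, both integrals below are finite and $$\int_O j_{\mathbf K(t,x)}\big(u(t,x)+v(t,x)\big)^2\,dx\ \ge\ \int_O j_{\mathbf K(t,x)}\big(u(t,x)\big)^2\,dx+\frac{c_0}{6R_0^2}\,|O'|\,|\bar v|^2;$$ 3. $\sup_{t\in I}\|z(t)\|_{H^{-1}(O)}<\eta$, where $H^{-1}(O)$ is the dual of $H^1_0(O)$. -/

import Mathlib

open Set MeasureTheory Topology
open scoped Pointwise ENNReal ContDiff Matrix.Norms.Frobenius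

noncomputable section

namespace EulerSub

/-- The Euclidean space `ℝⁿ`. -/
abbrev E (n : ℕ) : Type := EuclideanSpace ℝ (Fin n)

/-- The space of real symmetric trace-free `n × n` matrices (with the Frobenius norm). -/
def S0 (n : ℕ) : Submodule ℝ (Matrix (Fin n) (Fin n) ℝ) where
  carrier := {M | M.transpose = M ∧ M.trace = 0}
  add_mem' := by
    rintro A B ⟨hA, hA'⟩ ⟨hB, hB'⟩
    exact ⟨by rw [Matrix.transpose_add, hA, hB], by rw [Matrix.trace_add, hA', hB', add_zero]⟩
  zero_mem' := ⟨Matrix.transpose_zero, Matrix.trace_zero _ _⟩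
  smul_mem' := by
    rintro c A ⟨hA, hA'⟩
    exact ⟨by rw [Matrix.transpose_smul, hA], by rw [Matrix.trace_smul, hA', smul_zero]⟩

/-- The space of triples `(v, M, q)`. -/
abbrev State (n : ℕ) : Type := E n × S0 n × ℝ

/-- `F u = u ⊗ u - (|u|² / n) Iₙ` as a matrix. -/
def Fmat {n : ℕ} (u : E n) : Matrix (Fin n) (Fin n) ℝ :=
  Matrix.of fun i j => u i * u j - if i = j then ‖u‖ ^ 2 / n else 0

theorem Fmat_mem {n : ℕ} (u : E n) : Fmat u ∈ S0 n := by
  constructor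
  · ext i j
    simp only [Fmat, Matrix.transpose_apply, Matrix.of_apply, eq_comm (a := i) (b := j)]
    ring
  · rcases Nat.eq_zero_or_pos n with h | h
    · subst h
      simp [Matrix.trace]
    · have hn : (n : ℝ) ≠ 0 := by positivity
      simp only [Matrix.trace, Matrix.diag, Fmat, Matrix.of_apply, if_true,
        Finset.sum_sub_distrib, Finset.sum_const, Finset.card_univ, Fintype.card_fin,
        nsmul_eq_mul, EuclideanSpace.real_norm_sq_eq]
      rw [mul_div_cancel₀ _ hn, sub_eq_zero]
      exact Finset.sum_congr rfl fun i _ => (sq (u i)).symm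

/-- The map `F : ℝⁿ → S₀ⁿ`. -/
def F {n : ℕ} (u : E n) : S0 n := ⟨Fmat u, Fmat_mem u⟩

/-- Compact convex subsets of `ℝⁿ` containing a neighbourhood of `0`, with the Hausdorff distance
(the metric that Mathlib puts on `ConvexBody`). -/
abbrev Body (n : ℕ) : Type := {K : ConvexBody (E n) // (K : Set (E n)) ∈ 𝓝 0}

/-- The underlying set of a body. -/
abbrev Body.set {n : ℕ} (K : Body n) : Set (E n) := (K.1 : Set (E n))

/-- The gauge `j_K (x) = inf {r > 0, x ∈ r K}`. -/
def Body.j {n : ℕ} (K : Body n) (x : E n) : ℝ := gauge K.set x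

/-- `c`-uniform convexity of a body. -/
def Body.UnifConvex {n : ℕ} (K : Body n) (c : ℝ) : Prop :=
  ∀ x y : E n, 2 * K.j x ^ 2 + c * K.j y ^ 2 ≤ K.j (x + y) ^ 2 + K.j (x - y) ^ 2

/-- `r_max (K) = inf {R > 0, K ⊆ B(0, R)}`, with closed balls. -/
def Body.rmax {n : ℕ} (K : Body n) : ℝ := sInf {R : ℝ | 0 < R ∧ K.set ⊆ Metric.closedBall 0 R}

/-- `r_min (K) = sup {R ≥ 0, B(0, R) ⊆ K}`, with closed balls. -/
def Body.rmin {n : ℕ} (K : Body n) : ℝ := sSup {R : ℝ | 0 ≤ R ∧ Metric.closedBall 0 R ⊆ K.set}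

/-- The set `Λ_K (z₀, r)` of vectors `t (b - a, F b - F a, (|b|² - |a|²) / n)` with `t ≥ 0`,
`a, b ∈ v₀ + r ∂K`, and `a, b` not aligned. -/
def Lam {n : ℕ} (K : Body n) (z₀ : State n) (r : ℝ) : Set (State n) :=
  {l | ∃ t : ℝ, 0 ≤ t ∧ ∃ a ∈ z₀.1 +ᵥ r • frontier K.set, ∃ b ∈ z₀.1 +ᵥ r • frontier K.set,
    ‖b‖ ^ 2 * ‖a‖ ^ 2 ≠ (inner ℝ a b) ^ 2 ∧
    l = t • ((b - a, F b - F a, (‖b‖ ^ 2 - ‖a‖ ^ 2) / n) : State n)}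

/-- Time derivative of `f : ℝ × ℝⁿ → ℝ`. -/
def dt {n : ℕ} (f : ℝ × E n → ℝ) (p : ℝ × E n) : ℝ := fderiv ℝ f p (1, 0)

/-- Partial derivative of `f : ℝ × ℝⁿ → ℝ` in the space variable `x_i`. -/
def dx {n : ℕ} (i : Fin n) (f : ℝ × E n → ℝ) (p : ℝ × E n) : ℝ :=
  fderiv ℝ f p (0, EuclideanSpace.single i 1)

/-- The linear system `∂ₜ v + ∇ · M + ∇ q = 0`, `∇ · v = 0`, in the classical sense; it is used for
smooth `z = (v, M, q)` only. -/
def IsLinearSubsolution {n : ℕ} (z : ℝ × E n → State n) : Prop :=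
  ∀ p : ℝ × E n,
    (∀ i : Fin n, dt (fun p => (z p).1 i) p
      + ∑ j : Fin n, dx j (fun p => ((z p).2.1 : Matrix (Fin n) (Fin n) ℝ) i j) p
      + dx i (fun p => (z p).2.2) p = 0) ∧
    ∑ i : Fin n, dx i (fun p => (z p).1 i) p = 0

/-- `φ ∈ C_c^∞(O)` with `‖φ‖_{H¹}² = ∫ φ² + ∫ |∇ φ|² ≤ 1`. -/
structure IsUnitTest {n : ℕ} (O : Set (E n)) (φ : E n → ℝ) : Prop where
  smooth : ContDiff ℝ ∞ φ
  compact : HasCompactSupport φ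
  supp : tsupport φ ⊆ O
  norm_le : (∫ x, φ x ^ 2) + (∫ x, ‖fderiv ℝ φ x‖ ^ 2) ≤ 1

/-- The `H⁻¹(O)` norm of a (locally integrable) scalar function: its norm as a functional on
`H¹₀(O)`, which is the supremum over the dense subspace `C_c^∞(O)`. -/
def hNegNorm {n : ℕ} (O : Set (E n)) (f : E n → ℝ) : ℝ≥0∞ :=
  ⨆ (φ : E n → ℝ) (_ : IsUnitTest O φ), ‖∫ x in O, f x * φ x‖ₑ

/-- The `H⁻¹(O)` norm of a function with values in `ℝⁿ × S₀ⁿ × ℝ`: the Hilbert norm, that is the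
square root of the sum of the squares of the `H⁻¹(O)` norms of all its scalar components. -/
def hNegNormState {n : ℕ} (O : Set (E n)) (z : E n → State n) : ℝ≥0∞ :=
  ((∑ i : Fin n, hNegNorm O (fun x => (z x).1 i) ^ 2)
    + (∑ i : Fin n, ∑ j : Fin n,
        hNegNorm O (fun x => ((z x).2.1 : Matrix (Fin n) (Fin n) ℝ) i j) ^ 2)
    + hNegNorm O (fun x => (z x).2.2) ^ 2) ^ (1 / 2 : ℝ)

end EulerSub

end

/-! The subsolution is a single rapidly oscillating plane wave, cut off in space-time: z ≈ φ sin(Nξ)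
λ with N large, φ a cutoff equal to 1 on I_θ × O', and ξ a linear phase.

With c = τ(b - a) and d = b + a, the vector λ is the state whose velocity is c and whose total flux
M + qI is the symmetric part of c ⊗ d. A nonzero y orthogonal to b - a exists because n ≥ 2; it
provides a phase with ξ(0,c) = 0, ξ(2,d) = 0 and nonzero space gradient. To keep the linear system
exact after cutting off, z is built from second derivatives of a scalar potential ψ, arranged so
that the equations reduce to commutation of derivatives (`isLinearSubsolution_symState`). For ψ =
-N⁻² φ sin(Nξ) the second derivatives equal φ sin(Nξ) λ up to O(1/N). The outer derivative is always
purely spatial and falls on first derivatives of ψ, of size O(1/N); integrating it by parts gives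
smallness in H⁻¹ uniformly in time (`eventually_exists_localized_wave`).

For the energy, let G(p,w) = j(u+w)² - j(u)². Translating by half a period exchanges sin and -sin,
so asymptotically 2∫G(φ sin c) = ∫[G(φ sin c) + G(-φ sin c)] ≥ κ|c|² ∫φ² sin², with κ = c₀/R₀² by
uniform convexity. A quarter-period translation shows that sin² averages to 1/2. The gain is
therefore nearly κ/4 |c|² ∫φ² (`exists_eventually_energy_ge`), and the difference between 1/4 and
1/6 absorbs all errors. -/

noncomputable section

namespace EulerSub

/-! ### Calculus of directional derivatives. -/

section DirectionalDerivative

variable {X : Type*} [NormedAddCommGroup X] [NormedSpace ℝ X]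

/-- The derivative of `f` in the direction `e`. -/
def pd (e : X) (f : X → ℝ) : X → ℝ := fun p => fderiv ℝ f p e

theorem contDiff_pd {f : X → ℝ} (hf : ContDiff ℝ ∞ f) (e : X) : ContDiff ℝ ∞ (pd e f) :=
  (hf.fderiv_right (m := ∞) (by simp)).clm_apply contDiff_const

theorem pd_add_dir (e e' : X) (f : X → ℝ) : pd (e + e') f = pd e f + pd e' f := by
  ext p; simp [pd]

theorem pd_sub_dir (e e' : X) (f : X → ℝ) : pd (e - e') f = pd e f - pd e' f := by
  ext p; simp [pd]

theorem pd_smul_dir (a : ℝ) (e : X) (f : X → ℝ) : pd (a • e) f = a • pd e f := by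
  ext p; simp [pd]

theorem pd_sum_dir {ι : Type*} (s : Finset ι) (e : ι → X) (f : X → ℝ) :
    pd (∑ i ∈ s, e i) f = ∑ i ∈ s, pd (e i) f := by
  ext p; simp [pd]

theorem pd_sub {f g : X → ℝ} (hf : ContDiff ℝ ∞ f) (hg : ContDiff ℝ ∞ g) (e : X) :
    pd e (f - g) = pd e f - pd e g := by
  ext p
  simp [pd, fderiv_sub (hf.differentiable (by simp) p) (hg.differentiable (by simp) p)]

theorem pd_sum {ι : Type*} (s : Finset ι) {f : ι → X → ℝ} (hf : ∀ i, ContDiff ℝ ∞ (f i))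
    (e p : X) : pd e (fun p => ∑ i ∈ s, f i p) p = ∑ i ∈ s, pd e (f i) p := by
  have h := fderiv_fun_sum (𝕜 := ℝ) (u := s) (A := f) (x := p)
    fun i _ => (hf i).differentiable (by simp) p
  simp [pd, h]

theorem pd_smul {f : X → ℝ} (a : ℝ) (e : X) :
    pd e (a • f) = a • pd e f := by
  ext p
  simp [pd, fderiv_const_smul_field]

theorem pd_comm {f : X → ℝ} (hf : ContDiff ℝ ∞ f) (e e' : X) :
    pd e (pd e' f) = pd e' (pd e f) := by
  have key : ∀ (a b p : X), pd a (pd b f) p = fderiv ℝ (fderiv ℝ f) p a b := by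
    intro a b p
    have hd : DifferentiableAt ℝ (fderiv ℝ f) p :=
      (hf.fderiv_right (m := ∞) (by simp)).differentiable (by simp) p
    have h : fderiv ℝ (pd b f) p = _ := fderiv_clm_apply hd (differentiableAt_const b)
    rw [pd, h]
    simp
  ext p
  rw [key, key]
  have := hf.contDiffAt (x := p)
  exact (this.isSymmSndFDerivAt (by simp only [minSmoothness_of_isRCLikeNormedField]; exact WithTop.coe_le_coe.2 le_top)).eq e e'

theorem tsupport_pd_subset (e : X) (f : X → ℝ) : tsupport (pd e f) ⊆ tsupport f :=
  tsupport_fderiv_apply_subset ℝ e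

/-- This is the identity behind both equations of the system: with `e` the spatial basis, taking the
divergence turns the coefficients `α`, `β` into directions, so antisymmetric combinations of
derivatives cancel by commutation. -/
theorem sum_pd_pd_sub {ι : Type*} [Fintype ι] (e : ι → X) (α β : ι → ℝ) {f : X → ℝ}
    (hf : ContDiff ℝ ∞ f) (a b p : X) :
    ∑ j, pd (e j) (pd (α j • a - β j • b) f) p
      = pd (∑ i, α i • e i) (pd a f) p - pd (∑ i, β i • e i) (pd b f) p := by
  have h1 : ∀ (γ : ι → ℝ) (g : X → ℝ),
      pd (∑ i, γ i • e i) g p = ∑ i, γ i * pd (e i) g p := by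
    intro γ g
    rw [pd_sum_dir]
    simp [pd_smul_dir]
  have h2 : ∀ j, pd (e j) (pd (α j • a - β j • b) f) p
      = α j * pd (e j) (pd a f) p - β j * pd (e j) (pd b f) p := by
    intro j
    rw [pd_sub_dir, pd_sub (contDiff_pd hf _) (contDiff_pd hf _), pd_smul_dir, pd_smul_dir,
      pd_smul, pd_smul]
    simp
  simp only [h2, Finset.sum_sub_distrib, h1]

end DirectionalDerivative

/-! ### High-frequency expansion of the potential. -/

section Wave

variable {X : Type*} [NormedAddCommGroup X] [NormedSpace ℝ X]

/-- The potential of a localized plane wave of frequency `N` in the direction `ξ`. -/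
def wave (φ : X → ℝ) (ξ : X →L[ℝ] ℝ) (N : ℝ) : X → ℝ :=
  fun p => -(N⁻¹ ^ 2 * (φ p * Real.sin (N * ξ p)))

variable {φ : X → ℝ} {ξ : X →L[ℝ] ℝ} {N : ℝ}

theorem contDiff_wave (hφ : ContDiff ℝ ∞ φ) : ContDiff ℝ ∞ (wave φ ξ N) := by
  unfold wave
  fun_prop

theorem tsupport_wave_subset : tsupport (wave φ ξ N) ⊆ tsupport φ := by
  refine closure_mono fun p hp => ?_
  rw [Function.mem_support] at hp ⊢
  contrapose! hp
  simp [wave, hp]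

theorem hasFDerivAt_phase (p : X) : HasFDerivAt (fun p => N * ξ p) (N • ξ) p :=
  ξ.hasFDerivAt.const_mul N

theorem pd_wave (hφ : ContDiff ℝ ∞ φ) (hN : N ≠ 0) (e : X) :
    pd e (wave φ ξ N) = fun p => -(N⁻¹ ^ 2 * (pd e φ p * Real.sin (N * ξ p)))
      - N⁻¹ * (ξ e * (φ p * Real.cos (N * ξ p))) := by
  ext p
  have h := ((((hφ.differentiable (by simp) p).hasFDerivAt).mul
    (hasFDerivAt_phase (N := N) (ξ := ξ) p).sin).const_mul (N⁻¹ ^ 2)).neg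
  have h' : fderiv ℝ (wave φ ξ N) p = _ := h.fderiv
  simp only [pd, h']
  simp
  field_simp
  ring

/-- Two derivatives falling on the sine produce -N², which the prefactor -N⁻² normalizes to a term
of order one; every derivative falling on `φ` costs a factor N⁻¹. -/
theorem pd_pd_wave (hφ : ContDiff ℝ ∞ φ) (hN : N ≠ 0) (e e' : X) (p : X) :
    pd e (pd e' (wave φ ξ N)) p = ξ e * ξ e' * (φ p * Real.sin (N * ξ p))
      - N⁻¹ ^ 2 * (pd e (pd e' φ) p * Real.sin (N * ξ p))
      - N⁻¹ * ((ξ e * pd e' φ p + ξ e' * pd e φ p) * Real.cos (N * ξ p)) := by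
  rw [pd_wave hφ hN]
  have h1 := ((((contDiff_pd hφ e').differentiable (by simp) p).hasFDerivAt).mul
    (hasFDerivAt_phase (N := N) (ξ := ξ) p).sin).const_mul (N⁻¹ ^ 2) |>.neg
  have h2 := ((((hφ.differentiable (by simp) p).hasFDerivAt).mul
    (hasFDerivAt_phase (N := N) (ξ := ξ) p).cos).const_mul (ξ e')).const_mul (N⁻¹)
  have h' := congrArg (fun A : X →L[ℝ] ℝ => A e) (h1.sub h2).fderiv
  refine Eq.trans h' ?_
  have h3 : pd e (pd e' φ) p = fderiv ℝ (pd e' φ) p e := rfl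
  have h4 : pd e φ p = fderiv ℝ φ p e := rfl
  rw [h3, h4]
  simp
  field_simp
  ring

theorem exists_bound_pd (hφ : ContDiff ℝ ∞ φ) (hc : HasCompactSupport φ) :
    ∃ C : ℝ, ∀ p, |φ p| ≤ C :=
  (hc.exists_bound_of_continuous hφ.continuous)

theorem hasCompactSupport_pd (hc : HasCompactSupport φ) (e : X) : HasCompactSupport (pd e φ) :=
  hc.fderiv_apply ℝ e

open Filter in
theorem eventually_pd_wave_le (hφ : ContDiff ℝ ∞ φ) (hc : HasCompactSupport φ) (e : X)
    {ε : ℝ} (hε : 0 < ε) : ∀ᶠ N : ℝ in atTop, ∀ p, |pd e (wave φ ξ N) p| ≤ ε := by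
  obtain ⟨A, hA⟩ := exists_bound_pd hφ hc
  obtain ⟨B, hB⟩ := exists_bound_pd (contDiff_pd hφ e) (hasCompactSupport_pd hc e)
  have hlim : Tendsto (fun N : ℝ => N⁻¹ ^ 2 * B + N⁻¹ * (|ξ e| * A)) atTop (𝓝 0) := by
    have h := tendsto_inv_atTop_zero (𝕜 := ℝ)
    simpa using ((h.pow 2).mul_const B).add (h.mul_const (|ξ e| * A))
  filter_upwards [hlim.eventually (gt_mem_nhds hε), eventually_gt_atTop 0] with N hN hN0 p
  rw [pd_wave hφ hN0.ne']
  refine le_trans ?_ hN.le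
  refine (abs_sub _ _).trans (add_le_add ?_ ?_)
  · rw [abs_neg, abs_mul, abs_mul, abs_of_nonneg (by positivity : (0 : ℝ) ≤ N⁻¹ ^ 2)]
    gcongr
    calc |pd e φ p| * |Real.sin (N * ξ p)| ≤ |pd e φ p| * 1 := by
          gcongr; exact Real.abs_sin_le_one _
      _ ≤ B := by simpa using hB p
  · rw [abs_mul, abs_mul, abs_mul, abs_of_nonneg (by positivity : (0 : ℝ) ≤ N⁻¹)]
    gcongr
    calc |φ p| * |Real.cos (N * ξ p)| ≤ |φ p| * 1 := by
          gcongr; exact Real.abs_cos_le_one _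
      _ ≤ A := by simpa using hA p

open Filter in
theorem eventually_pd_pd_wave_le (hφ : ContDiff ℝ ∞ φ) (hc : HasCompactSupport φ) (e e' : X)
    {ε : ℝ} (hε : 0 < ε) : ∀ᶠ N : ℝ in atTop, ∀ p,
      |pd e (pd e' (wave φ ξ N)) p - ξ e * ξ e' * (φ p * Real.sin (N * ξ p))| ≤ ε := by
  obtain ⟨A, hA⟩ := exists_bound_pd (contDiff_pd (contDiff_pd hφ e') e)
    (hasCompactSupport_pd (hasCompactSupport_pd hc e') e)
  have hs : ContDiff ℝ ∞ (fun p => ξ e * pd e' φ p + ξ e' * pd e φ p) :=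
    (contDiff_const.mul (contDiff_pd hφ e')).add (contDiff_const.mul (contDiff_pd hφ e))
  obtain ⟨B, hB⟩ := exists_bound_pd hs
    ((hasCompactSupport_pd hc e').mul_left.add (hasCompactSupport_pd hc e).mul_left)
  have hlim : Tendsto (fun N : ℝ => N⁻¹ ^ 2 * A + N⁻¹ * B) atTop (𝓝 0) := by
    have h := tendsto_inv_atTop_zero (𝕜 := ℝ)
    simpa using ((h.pow 2).mul_const A).add (h.mul_const B)
  filter_upwards [hlim.eventually (gt_mem_nhds hε), eventually_gt_atTop 0] with N hN hN0 p
  rw [pd_pd_wave hφ hN0.ne', ← abs_neg, neg_sub, sub_sub, sub_sub_cancel]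
  refine le_trans ?_ hN.le
  refine (abs_add_le _ _).trans (add_le_add ?_ ?_)
  · rw [abs_mul, abs_mul, abs_of_nonneg (by positivity : (0 : ℝ) ≤ N⁻¹ ^ 2)]
    gcongr
    calc |pd e (pd e' φ) p| * |Real.sin (N * ξ p)| ≤ |pd e (pd e' φ) p| * 1 := by
          gcongr; exact Real.abs_sin_le_one _
      _ ≤ A := by simpa using hA p
  · rw [abs_mul, abs_mul, abs_of_nonneg (by positivity : (0 : ℝ) ≤ N⁻¹)]
    gcongr
    calc |ξ e * pd e' φ p + ξ e' * pd e φ p| * |Real.cos (N * ξ p)|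
        ≤ |ξ e * pd e' φ p + ξ e' * pd e φ p| * 1 := by
          gcongr; exact Real.abs_cos_le_one _
      _ ≤ B := by simpa using hB p

end Wave

/-! ### Linear maps in finite dimension and symmetrized rank one states. -/

section FiniteDimensional

variable {V W : Type*} [NormedAddCommGroup V] [NormedSpace ℝ V] [FiniteDimensional ℝ V]
  [NormedAddCommGroup W] [NormedSpace ℝ W]

theorem contDiff_linearMap (f : V →ₗ[ℝ] W) : ContDiff ℝ ∞ f :=
  (LinearMap.toContinuousLinearMap f).contDiff

theorem exists_norm_linearMap_le (f : V →ₗ[ℝ] W) : ∃ C : ℝ, 0 ≤ C ∧ ∀ v, ‖f v‖ ≤ C * ‖v‖ :=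
  ⟨‖LinearMap.toContinuousLinearMap f‖, norm_nonneg _,
    (LinearMap.toContinuousLinearMap f).le_opNorm⟩

end FiniteDimensional

/-- The state `(v, (g + gᵀ) / 2 - (tr g / n) I, tr g / n)` with velocity `v` whose momentum flux is
the symmetric part of `g`. -/
def symState (n : ℕ) : ((Fin n → ℝ) × (Fin n → Fin n → ℝ)) →ₗ[ℝ] State n where
  toFun w := (WithLp.toLp 2 w.1,
    ⟨Matrix.of fun i j => (w.2 i j + w.2 j i) / 2 - if i = j then (∑ k, w.2 k k) / n else 0, by
      constructor
      · ext i j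
        simp only [Matrix.transpose_apply, Matrix.of_apply, eq_comm (a := i) (b := j)]
        ring
      · rcases Nat.eq_zero_or_pos n with h | h
        · subst h
          simp [Matrix.trace]
        · have hn : (n : ℝ) ≠ 0 := by positivity
          simp only [Matrix.trace, Matrix.diag, Matrix.of_apply, if_true, add_self_div_two,
            Finset.sum_sub_distrib, Finset.sum_const, Finset.card_univ, Fintype.card_fin,
            nsmul_eq_mul]
          rw [mul_div_cancel₀ _ hn, sub_self]⟩,
    (∑ k, w.2 k k) / n)
  map_add' w w' := by
    refine Prod.ext ?_ (Prod.ext (Subtype.ext ?_) ?_)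
    · rfl
    · ext i j
      simp only [Prod.snd_add, Pi.add_apply, Matrix.of_apply, Prod.fst_add, Submodule.coe_add,
        Matrix.add_apply, Finset.sum_add_distrib]
      split_ifs <;> ring
    · simp only [Prod.snd_add, Pi.add_apply, Finset.sum_add_distrib]
      ring
  map_smul' a w := by
    refine Prod.ext ?_ (Prod.ext (Subtype.ext ?_) ?_)
    · rfl
    · ext i j
      simp only [Prod.smul_snd, Pi.smul_apply, smul_eq_mul, Matrix.of_apply, Prod.smul_fst,
        Submodule.coe_smul, Matrix.smul_apply, ← Finset.mul_sum, RingHom.id_apply]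
      split_ifs <;> ring
    · simp only [Prod.smul_snd, Pi.smul_apply, smul_eq_mul, ← Finset.mul_sum, RingHom.id_apply]
      ring

theorem symState_fst {n : ℕ} (w : (Fin n → ℝ) × (Fin n → Fin n → ℝ)) (i : Fin n) :
    (symState n w).1 i = w.1 i := rfl

theorem symState_mat {n : ℕ} (w : (Fin n → ℝ) × (Fin n → Fin n → ℝ)) (i j : Fin n) :
    ((symState n w).2.1 : Matrix (Fin n) (Fin n) ℝ) i j
      = (w.2 i j + w.2 j i) / 2 - if i = j then (∑ k, w.2 k k) / n else 0 := rfl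

theorem symState_snd {n : ℕ} (w : (Fin n → ℝ) × (Fin n → Fin n → ℝ)) :
    (symState n w).2.2 = (∑ k, w.2 k k) / n := rfl

/-- The vectors `t (b - a, F b - F a, (|b|² - |a|²) / n)` are symmetrized rank one states. -/
theorem smul_diff_eq_symState {n : ℕ} (a b : E n) (t : ℝ) :
    (t • ((b - a, F b - F a, (‖b‖ ^ 2 - ‖a‖ ^ 2) / n) : State n))
      = symState n (fun i => (t • (b - a)) i, fun i j => (t • (b - a)) i * (b + a) j) := by
  have hsum : ∑ k, (t • (b - a)) k * (b + a) k = t * (‖b‖ ^ 2 - ‖a‖ ^ 2) := by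
    rw [EuclideanSpace.real_norm_sq_eq, EuclideanSpace.real_norm_sq_eq, ← Finset.sum_sub_distrib,
      Finset.mul_sum]
    refine Finset.sum_congr rfl fun k _ => ?_
    simp
    ring
  refine Prod.ext ?_ (Prod.ext (Subtype.ext ?_) ?_)
  · rfl
  · ext i j
    rw [symState_mat]
    simp only [hsum]
    simp only [F, Fmat, Prod.smul_mk, Submodule.coe_smul, Submodule.coe_sub, Matrix.smul_apply,
      Matrix.sub_apply, Matrix.of_apply, smul_eq_mul, PiLp.smul_apply, PiLp.sub_apply,
      PiLp.add_apply]
    split_ifs <;> ring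
  · rw [symState_snd]
    simp only [hsum, Prod.smul_mk, smul_eq_mul]
    ring

/-! ### Exact subsolutions from a scalar potential. -/

section Potential

variable {n : ℕ}

/-- The directions `c_i ζ - ζ_i c`. -/
def velDir (c ζ : E n) (i : Fin n) : ℝ × E n := c i • ((0, ζ) : ℝ × E n) - ζ i • ((0, c) : ℝ × E n)

/-- The directions `d_j ζ - ζ_j (d, 2)`. -/
def fluxDir (d ζ : E n) (j : Fin n) : ℝ × E n :=
  d j • ((0, ζ) : ℝ × E n) - ζ j • ((2, d) : ℝ × E n)

/-- The second derivatives of the potential `ψ` that make up a subsolution. -/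
def potentialJet (c d ζ : E n) (ψ : ℝ × E n → ℝ) (p : ℝ × E n) :
    (Fin n → ℝ) × (Fin n → Fin n → ℝ) :=
  (fun i => pd (velDir c ζ i) (pd (0, ζ) ψ) p,
    fun i j => pd (velDir c ζ i) (pd (fluxDir d ζ j) ψ) p)

variable {c d ζ : E n} {ψ : ℝ × E n → ℝ}

theorem contDiff_potentialJet (hψ : ContDiff ℝ ∞ ψ) : ContDiff ℝ ∞ (potentialJet c d ζ ψ) := by
  refine ContDiff.prodMk ?_ ?_
  · exact contDiff_pi.2 fun i => contDiff_pd (contDiff_pd hψ _) _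
  · exact contDiff_pi.2 fun i => contDiff_pi.2 fun j => contDiff_pd (contDiff_pd hψ _) _

theorem tsupport_symState_potentialJet :
    tsupport (fun p => symState n (potentialJet c d ζ ψ p)) ⊆ tsupport ψ := by
  refine closure_minimal (fun p hp => ?_) isClosed_closure
  by_contra h
  refine hp ?_
  have h1 : ∀ e e', pd e (pd e' ψ) p = 0 := fun e e' =>
    image_eq_zero_of_notMem_tsupport fun hp' =>
      h (tsupport_pd_subset _ _ (tsupport_pd_subset _ _ hp'))
  have : potentialJet c d ζ ψ p = 0 := by
    refine Prod.ext ?_ ?_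
    · ext i; simp [potentialJet, h1]
    · ext i j; simp [potentialJet, h1]
  simp [this]

theorem sum_smul_single (c : E n) :
    ∑ i, c i • ((0, EuclideanSpace.single i 1) : ℝ × E n) = (0, c) := by
  refine Prod.ext ?_ ?_
  · simp [Prod.fst_sum]
  · ext j
    simp [Prod.snd_sum, Pi.single_apply]

theorem dx_matrix_entry {A B T : ℝ × E n → ℝ} (hA : ContDiff ℝ ∞ A) (hB : ContDiff ℝ ∞ B)
    (hT : ContDiff ℝ ∞ T) (i j : Fin n) (p : ℝ × E n) :
    dx j (fun p => (A p + B p) / 2 - if i = j then T p else 0) p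
      = (dx j A p + dx j B p) / 2 - if i = j then dx j T p else 0 := by
  have hA' := (hA.differentiable (by simp) p).hasFDerivAt
  have hB' := (hB.differentiable (by simp) p).hasFDerivAt
  have hT' := (hT.differentiable (by simp) p).hasFDerivAt
  have h1 := (hA'.add hB').mul_const (2 : ℝ)⁻¹
  by_cases h : i = j
  · simp only [if_pos h, dx, div_eq_mul_inv]
    have h2 := congrArg (fun A : (ℝ × E n) →L[ℝ] ℝ => A (0, EuclideanSpace.single j 1))
      (h1.sub hT').fderiv
    refine Eq.trans h2 ?_
    simp
    ring
  · simp only [if_neg h, dx, div_eq_mul_inv, sub_zero]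
    have h2 := congrArg (fun A : (ℝ × E n) →L[ℝ] ℝ => A (0, EuclideanSpace.single j 1)) h1.fderiv
    refine Eq.trans h2 ?_
    simp
    ring

/-- The divergence of g over its first index vanishes, and over its second index it is -2 ∂ₜ v; the
symmetric part of g, which is M + qI, thus has divergence -∂ₜ v. -/
theorem isLinearSubsolution_symState (hψ : ContDiff ℝ ∞ ψ) :
    IsLinearSubsolution (fun p => symState n (potentialJet c d ζ ψ p)) := by
  have hg : ∀ e e', ContDiff ℝ ∞ (pd e (pd e' ψ)) := fun e e' =>
    contDiff_pd (contDiff_pd hψ _) _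
  have h1 : ∀ (g : ℝ × E n → ℝ), ContDiff ℝ ∞ g → ∀ p,
      ∑ j, pd (0, EuclideanSpace.single j 1) (pd (velDir c ζ j) g) p = 0 := by
    intro g hg p
    unfold velDir
    rw [sum_pd_pd_sub (fun j : Fin n => ((0, EuclideanSpace.single j 1) : ℝ × E n)) c ζ hg,
      sum_smul_single, sum_smul_single, pd_comm hg, sub_self]
  intro p
  constructor
  · intro i
    have h2 : ∀ p, ∑ j, pd (0, EuclideanSpace.single j 1) (pd (fluxDir d ζ j) ψ) p
        = - 2 * pd (1, 0) (pd (0, ζ) ψ) p := by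
      intro p
      -- Derivatives along `d` and `ζ` commute and cancel; only the time component of `(2, d)`
      -- survives. The 2 compensates the 1/2 of the symmetrization.
      have hd : ((2, d) : ℝ × E n) = (0, d) + (2 : ℝ) • (1, 0) := by ext <;> simp
      unfold fluxDir
      rw [sum_pd_pd_sub (fun j : Fin n => ((0, EuclideanSpace.single j 1) : ℝ × E n)) d ζ hψ,
        sum_smul_single, sum_smul_single, pd_comm hψ _ (2, d), hd, pd_add_dir, pd_smul_dir]
      simp
    have h3 : ∑ j, pd (0, EuclideanSpace.single j 1)
        (pd (velDir c ζ i) (pd (fluxDir d ζ j) ψ)) p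
        = - 2 * pd (1, 0) (pd (velDir c ζ i) (pd (0, ζ) ψ)) p := by
      have h4 : (fun p => ∑ j, pd (0, EuclideanSpace.single j 1) (pd (fluxDir d ζ j) ψ) p)
        = (-2 : ℝ) • pd (1, 0) (pd (0, ζ) ψ) := by
        ext p; simp [h2]
      have h5 := congrArg (fun f => pd (velDir c ζ i) f p) h4
      simp only [pd_smul, Pi.smul_apply, smul_eq_mul] at h5
      rw [pd_comm (contDiff_pd hψ _) (1, 0), ← h5]
      have h6 : pd (velDir c ζ i)
          (fun p => ∑ j, pd (0, EuclideanSpace.single j 1) (pd (fluxDir d ζ j) ψ) p) p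
          = ∑ j, pd (velDir c ζ i)
            (pd (0, EuclideanSpace.single j 1) (pd (fluxDir d ζ j) ψ)) p := by
        exact pd_sum _ (fun j => hg _ _) _ _
      rw [h6]
      exact Finset.sum_congr rfl fun j _ => by rw [pd_comm (contDiff_pd hψ _)]
    have hT : ContDiff ℝ ∞ fun p => (∑ k, (potentialJet c d ζ ψ p).2 k k) / n :=
      (ContDiff.sum fun k _ => hg _ _).div_const _
    simp only [symState_fst, symState_mat, symState_snd]
    have h7 := fun j => dx_matrix_entry (A := fun p => (potentialJet c d ζ ψ p).2 i j)
      (B := fun p => (potentialJet c d ζ ψ p).2 j i) (hg _ _) (hg _ _) hT i j p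
    simp only [h7, Finset.sum_sub_distrib, ← Finset.sum_div, Finset.sum_add_distrib,
      Finset.sum_ite_eq, Finset.mem_univ, if_true]
    have h8 : ∑ j, dx j (fun p => (potentialJet c d ζ ψ p).2 j i) p = 0 :=
      h1 _ (contDiff_pd hψ _) p
    have h9 : ∑ j, dx j (fun p => (potentialJet c d ζ ψ p).2 i j) p
      = - 2 * dt (fun p => (potentialJet c d ζ ψ p).1 i) p := h3
    rw [h8, h9]
    simp only [Finset.sum_div]
    ring
  · exact h1 _ (contDiff_pd hψ _) p

end Potential

/-! ### Estimates in H⁻¹. -/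

section NegNorm

variable {n : ℕ} {O : Set (E n)}

theorem setIntegral_eq_integral_of_test {φ : E n → ℝ} (hφ : IsUnitTest O φ) (f : E n → ℝ) :
    ∫ x in O, f x * φ x = ∫ x, f x * φ x := by
  refine setIntegral_eq_integral_of_forall_compl_eq_zero fun x hx => ?_
  rw [image_eq_zero_of_notMem_tsupport fun h => hx (hφ.supp h), mul_zero]

/-- Spatial derivatives of uniformly small functions are small in `H⁻¹`. -/
theorem abs_setIntegral_pd_mul_le (hO : IsOpen O) (hO_bdd : Bornology.IsBounded O)
    {k : ℝ × E n → ℝ} (hk : ContDiff ℝ ∞ k) {B : ℝ} (hB : ∀ p, |k p| ≤ B) (e : E n) (t : ℝ)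
    {φ : E n → ℝ} (hφ : IsUnitTest O φ) :
    |∫ x in O, pd (0, e) k (t, x) * φ x| ≤ ‖e‖ * B * (volume.real O + 1) := by
  have hB0 : 0 ≤ B := (abs_nonneg _).trans (hB 0)
  have hkt : ContDiff ℝ ∞ fun x => k (t, x) := hk.comp (contDiff_const.prodMk contDiff_id)
  have hpd : ∀ x, pd (0, e) k (t, x) = fderiv ℝ (fun x => k (t, x)) x e := by
    intro x
    have h1 : HasFDerivAt (fun x => k (t, x)) _ x :=
      ((hk.differentiable (by simp) (t, x)).hasFDerivAt).comp x (hasFDerivAt_prodMk_right t x)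
    rw [h1.fderiv]
    simp [pd]
  have hφ' : Continuous fun x => fderiv ℝ φ x := hφ.smooth.continuous_fderiv (by simp)
  have hkt' : Continuous fun x => fderiv ℝ (fun x => k (t, x)) x :=
    hkt.continuous_fderiv (by simp)
  have hc' : HasCompactSupport (fderiv ℝ φ) := hφ.compact.fderiv ℝ
  have hparts : ∫ x, φ x * fderiv ℝ (fun x => k (t, x)) x e
      = -∫ x, fderiv ℝ φ x e * k (t, x) := by
    refine integral_mul_fderiv_eq_neg_fderiv_mul_of_integrable ?_ ?_ ?_
      (fun x _ => hφ.smooth.differentiable (by simp) x)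
      (fun x _ => hkt.differentiable (by simp) x)
    · refine Continuous.integrable_of_hasCompactSupport ?_ ?_
      · exact (hφ'.clm_apply continuous_const).mul hkt.continuous
      · exact (hφ.compact.fderiv_apply ℝ e).mul_right
    · refine Continuous.integrable_of_hasCompactSupport ?_ ?_
      · exact hφ.smooth.continuous.mul (hkt'.clm_apply continuous_const)
      · exact hφ.compact.mul_right
    · exact Continuous.integrable_of_hasCompactSupport
        (hφ.smooth.continuous.mul hkt.continuous) hφ.compact.mul_right
  have hsq : Integrable fun x => ‖fderiv ℝ φ x‖ ^ 2 := by
    refine Continuous.integrable_of_hasCompactSupport (hφ'.norm.pow 2) ?_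
    exact hc'.comp_left (g := fun A => ‖A‖ ^ 2) (by simp)
  have hind : Integrable (O.indicator fun _ => (1 : ℝ)) :=
    (integrable_indicator_iff hO.measurableSet).2
      (integrableOn_const hO_bdd.measure_lt_top.ne)
  have hpt : ∀ x, ‖fderiv ℝ φ x e * k (t, x)‖
      ≤ ‖e‖ * B * (O.indicator (fun _ => (1 : ℝ)) x + ‖fderiv ℝ φ x‖ ^ 2) := by
    intro x
    by_cases hx : x ∈ O
    · rw [indicator_of_mem hx, norm_mul]
      calc ‖fderiv ℝ φ x e‖ * ‖k (t, x)‖ ≤ (‖fderiv ℝ φ x‖ * ‖e‖) * B :=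
            mul_le_mul ((fderiv ℝ φ x).le_opNorm e) (hB _) (norm_nonneg _) (by positivity)
        _ = ‖e‖ * B * ‖fderiv ℝ φ x‖ := by ring
        _ ≤ _ := by
            gcongr
            -- The bound s ≤ 1 + s² replaces Cauchy–Schwarz; integrated over `O` it gives |O| plus
            -- the Dirichlet energy, which is at most 1.
            nlinarith [sq_nonneg (‖fderiv ℝ φ x‖ - 1), norm_nonneg (fderiv ℝ φ x)]
    · have : fderiv ℝ φ x = 0 := image_eq_zero_of_notMem_tsupport fun h =>
        hx (hφ.supp (tsupport_fderiv_subset ℝ h))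
      simp [this, hx]
  rw [setIntegral_eq_integral_of_test hφ]
  simp only [hpd, mul_comm _ (φ _)]
  rw [hparts, abs_neg, ← Real.norm_eq_abs]
  refine (norm_integral_le_of_norm_le ((hind.add hsq).const_mul _)
    (Filter.Eventually.of_forall hpt)).trans ?_
  rw [integral_const_mul]
  refine mul_le_mul_of_nonneg_left ?_ (by positivity)
  rw [integral_add' hind hsq, integral_indicator hO.measurableSet, setIntegral_const, smul_eq_mul,
    mul_one]
  have := hφ.norm_le
  have h0 : 0 ≤ ∫ x, φ x ^ 2 := integral_nonneg fun x => sq_nonneg _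
  linarith

/-- The coordinates of a state, as linear functionals. -/
def velCoord (i : Fin n) : State n →ₗ[ℝ] ℝ where
  toFun z := z.1 i
  map_add' _ _ := rfl
  map_smul' _ _ := rfl

/-- The entries of the matrix component, as linear functionals. -/
def matCoord (i j : Fin n) : State n →ₗ[ℝ] ℝ where
  toFun z := (z.2.1 : Matrix (Fin n) (Fin n) ℝ) i j
  map_add' _ _ := rfl
  map_smul' _ _ := rfl

/-- The last component, as a linear functional. -/
def pressureCoord : State n →ₗ[ℝ] ℝ where
  toFun z := z.2.2
  map_add' _ _ := rfl
  map_smul' _ _ := rfl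

theorem hNegNorm_comp_le {G : Type*} [NormedAddCommGroup G] [NormedSpace ℝ G] [CompleteSpace G]
    {w : E n → G} (hw : Continuous w) (Λ : G →L[ℝ] ℝ) {B : ℝ}
    (h : ∀ φ, IsUnitTest O φ → ‖∫ x in O, φ x • w x‖ ≤ B) :
    hNegNorm O (fun x => Λ (w x)) ≤ ENNReal.ofReal (‖Λ‖ * B) := by
  refine iSup₂_le fun φ hφ => ?_
  have hint : Integrable (fun x => φ x • w x) (volume.restrict O) :=
    (Continuous.integrable_of_hasCompactSupport (hφ.smooth.continuous.smul hw)
      hφ.compact.smul_right).restrict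
  have h1 : ∫ x in O, Λ (w x) * φ x = Λ (∫ x in O, φ x • w x) := by
    rw [← Λ.integral_comp_comm hint]
    simp [mul_comm]
  rw [h1, ← ofReal_norm]
  exact ENNReal.ofReal_le_ofReal ((Λ.le_opNorm _).trans (by gcongr; exact h φ hφ))

theorem hNegNormState_le {z : E n → State n} {δ : ℝ≥0∞}
    (hv : ∀ i, hNegNorm O (fun x => velCoord i (z x)) ≤ δ)
    (hM : ∀ i j, hNegNorm O (fun x => matCoord i j (z x)) ≤ δ)
    (hq : hNegNorm O (fun x => pressureCoord (z x)) ≤ δ) :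
    hNegNormState O z ≤ (n + n * n + 1 : ℕ) * δ := by
  have h1 : (∑ i : Fin n, hNegNorm O (fun x => (z x).1 i) ^ 2)
      + (∑ i : Fin n, ∑ j : Fin n,
        hNegNorm O (fun x => ((z x).2.1 : Matrix (Fin n) (Fin n) ℝ) i j) ^ 2)
      + hNegNorm O (fun x => (z x).2.2) ^ 2 ≤ ((n + n * n + 1 : ℕ) * δ) ^ 2 := by
    calc _ ≤ (∑ _i : Fin n, δ ^ 2) + (∑ _i : Fin n, ∑ _j : Fin n, δ ^ 2) + δ ^ 2 := by
          gcongr with i _ i _ j _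
          · exact hv i
          · exact hM i j
          · exact hq
      _ = (n + n * n + 1 : ℕ) * δ ^ 2 := by
          simp only [Finset.sum_const, Finset.card_univ, Fintype.card_fin, nsmul_eq_mul]
          push_cast
          ring
      _ ≤ ((n + n * n + 1 : ℕ) : ℝ≥0∞) ^ 2 * δ ^ 2 := by
          gcongr
          exact_mod_cast Nat.le_self_pow (by norm_num) _
      _ = _ := by ring
  unfold hNegNormState
  refine (ENNReal.rpow_le_rpow h1 (by norm_num)).trans_eq ?_
  rw [← ENNReal.rpow_natCast, ← ENNReal.rpow_mul]
  norm_num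

open Filter in
/-- States whose jets are small in `H⁻¹` are small in `H⁻¹`. -/
theorem exists_hNegNormState_symState_le (n : ℕ) {ε : ℝ} (hε : 0 < ε) : ∃ B : ℝ, 0 < B ∧
    ∀ (O : Set (E n)) (w : E n → (Fin n → ℝ) × (Fin n → Fin n → ℝ)), Continuous w →
      (∀ φ, IsUnitTest O φ → ‖∫ x in O, φ x • w x‖ ≤ B) →
      hNegNormState O (fun x => symState n (w x)) ≤ ENNReal.ofReal ε := by
  -- Each coordinate only requires `B` small enough; phrasing this as an eventual statement at 0⁺
  -- lets finitely many coordinates share one `B`.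
  have key : ∀ Λ : State n →ₗ[ℝ] ℝ, ∀ᶠ B : ℝ in 𝓝[>] 0, ∀ (O : Set (E n))
      (w : E n → (Fin n → ℝ) × (Fin n → Fin n → ℝ)), Continuous w →
      (∀ φ, IsUnitTest O φ → ‖∫ x in O, φ x • w x‖ ≤ B) →
      hNegNorm O (fun x => Λ (symState n (w x))) ≤ ENNReal.ofReal (ε / (n + n * n + 1 : ℕ)) := by
    intro Λ
    set Λ' := LinearMap.toContinuousLinearMap (Λ ∘ₗ symState n)
    have hlim : Tendsto (fun B : ℝ => ‖Λ'‖ * B) (𝓝[>] 0) (𝓝 0) := by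
      have : Tendsto (fun B : ℝ => ‖Λ'‖ * B) (𝓝 0) (𝓝 (‖Λ'‖ * 0)) := tendsto_id.const_mul _
      rw [mul_zero] at this
      exact this.mono_left nhdsWithin_le_nhds
    have hpos : 0 < ε / (n + n * n + 1 : ℕ) := by positivity
    filter_upwards [hlim.eventually (gt_mem_nhds hpos)] with B hB O w hw h
    exact (hNegNorm_comp_le hw Λ' h).trans (ENNReal.ofReal_le_ofReal hB.le)
  obtain ⟨B, ⟨⟨hv, hM⟩, hq⟩, hB⟩ := (((eventually_all.2 fun i => key (velCoord i)).and
    (eventually_all.2 fun i => eventually_all.2 fun j => key (matCoord i j))).and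
    (key pressureCoord)).and self_mem_nhdsWithin |>.exists
  refine ⟨B, hB, fun O w hw h => (hNegNormState_le (fun i => hv i O w hw h)
    (fun i j => hM i j O w hw h) (hq O w hw h)).trans_eq ?_⟩
  rw [← ENNReal.ofReal_natCast, ← ENNReal.ofReal_mul (by positivity), mul_div_cancel₀]
  positivity

end NegNorm

/-! ### Localized plane waves. -/

section LocalizedWave

variable {n : ℕ} {O : Set (E n)}

theorem velDir_eq (c ζ : E n) (i : Fin n) : velDir c ζ i = (0, c i • ζ - ζ i • c) := by
  ext <;> simp [velDir]

-- The conditions on `ξ` say that it takes the values `c i` and `d j` on `velDir` and `fluxDir`, so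
-- the leading part of the jet of the wave is exactly `c`, `c ⊗ d` times φ sin(Nξ). The error and
-- the H⁻¹ bounds are finitely many conditions on large N.
open Filter in
theorem eventually_exists_localized_wave (hO : IsOpen O) (hO_bdd : Bornology.IsBounded O)
    {c d ζ : E n} {ξ : ℝ × E n →L[ℝ] ℝ} (hζ : ξ (0, ζ) = 1) (hc : ξ (0, c) = 0)
    (hd : ξ (2, d) = 0) {φ : ℝ × E n → ℝ} (hφ : ContDiff ℝ ∞ φ) (hφc : HasCompactSupport φ)
    {ε : ℝ} (hε : 0 < ε) : ∀ᶠ N : ℝ in atTop, ∃ z : ℝ × E n → State n,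
      ContDiff ℝ ∞ z ∧ tsupport z ⊆ tsupport φ ∧ IsLinearSubsolution z ∧
      (∀ p, ‖z p - (φ p * Real.sin (N * ξ p)) • symState n (fun i => c i, fun i j => c i * d j)‖
        ≤ ε) ∧
      ∀ t, hNegNormState O (fun x => z (t, x)) ≤ ENNReal.ofReal ε := by
  obtain ⟨B, hB, hneg⟩ := exists_hNegNormState_symState_le n hε
  obtain ⟨L, hL, hLle⟩ := exists_norm_linearMap_le (symState n)
  obtain ⟨ρ, hρ, hsmall⟩ : ∃ ρ : ℝ, 0 < ρ ∧ L * ρ ≤ ε := by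
    refine ⟨ε / (L + 1), by positivity, ?_⟩
    rw [mul_div_assoc', div_le_iff₀ (by positivity)]
    nlinarith
  have hξv : ∀ i, ξ (velDir c ζ i) = c i := by
    intro i
    simp only [velDir, map_sub, map_smul, hζ, hc]
    simp
  have hξf : ∀ j, ξ (fluxDir d ζ j) = d j := by
    intro i
    simp only [fluxDir, map_sub, map_smul, hζ, hd]
    simp
  have hbd : ∀ i : Fin n, ∃ β : ℝ, 0 < β ∧
      ‖c i • ζ - ζ i • c‖ * β * (volume.real O + 1) ≤ B := by
    intro i
    set A := ‖c i • ζ - ζ i • c‖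
    have hv : 0 ≤ volume.real O := measureReal_nonneg
    refine ⟨B / ((A + 1) * (volume.real O + 1)), by positivity, ?_⟩
    rw [mul_div_assoc', div_mul_eq_mul_div, div_le_iff₀ (by positivity)]
    have : 0 ≤ B * (volume.real O + 1) := by positivity
    nlinarith
  choose β hβ hβB using hbd
  have e1 := fun i => eventually_pd_pd_wave_le (ξ := ξ) hφ hφc (velDir c ζ i) (0, ζ) hρ
  have e2 := fun i j => eventually_pd_pd_wave_le (ξ := ξ) hφ hφc (velDir c ζ i) (fluxDir d ζ j) hρ
  have e3 := fun i => eventually_pd_wave_le (ξ := ξ) hφ hφc (0, ζ) (hβ i)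
  have e4 := fun i j => eventually_pd_wave_le (ξ := ξ) hφ hφc (fluxDir d ζ j) (hβ i)
  filter_upwards [eventually_all.2 e1, eventually_all.2 fun i => eventually_all.2 (e2 i),
    eventually_all.2 e3, eventually_all.2 fun i => eventually_all.2 (e4 i)] with N h1 h2 h3 h4
  have hψ : ContDiff ℝ ∞ (wave φ ξ N) := contDiff_wave hφ
  have hjet := contDiff_potentialJet (c := c) (d := d) (ζ := ζ) hψ
  refine ⟨fun p => symState n (potentialJet c d ζ (wave φ ξ N) p),
    (contDiff_linearMap (symState n)).comp hjet,
    tsupport_symState_potentialJet.trans tsupport_wave_subset,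
    isLinearSubsolution_symState hψ, fun p => ?_, fun t => ?_⟩
  · rw [← map_smul, ← map_sub]
    refine (hLle _).trans (le_trans ?_ hsmall)
    gcongr
    refine norm_prod_le_iff.2 ⟨?_, ?_⟩
    · refine (pi_norm_le_iff_of_nonneg hρ.le).2 fun i => ?_
      have := h1 i p
      rw [hξv, hζ] at this
      simpa [potentialJet, mul_comm, mul_assoc, mul_left_comm] using this
    · refine (pi_norm_le_iff_of_nonneg hρ.le).2 fun i => ?_
      refine (pi_norm_le_iff_of_nonneg hρ.le).2 fun j => ?_
      have := h2 i j p
      rw [hξv, hξf] at this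
      simpa [potentialJet, mul_comm, mul_assoc, mul_left_comm] using this
  · have hcont : Continuous fun x => potentialJet c d ζ (wave φ ξ N) (t, x) :=
      hjet.continuous.comp (by fun_prop)
    refine hneg O _ hcont fun χ hχ => ?_
    have hint : Integrable (fun x => χ x • potentialJet c d ζ (wave φ ξ N) (t, x))
        (volume.restrict O) :=
      (Continuous.integrable_of_hasCompactSupport (hχ.smooth.continuous.smul hcont)
        hχ.compact.smul_right).restrict
    have hcoord : ∀ Λ : ((Fin n → ℝ) × (Fin n → Fin n → ℝ)) →L[ℝ] ℝ,
        Λ (∫ x in O, χ x • potentialJet c d ζ (wave φ ξ N) (t, x))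
          = ∫ x in O, Λ (potentialJet c d ζ (wave φ ξ N) (t, x)) * χ x := by
      intro Λ
      rw [← Λ.integral_comp_comm hint]
      simp [mul_comm]
    refine norm_prod_le_iff.2 ⟨?_, ?_⟩
    · refine (pi_norm_le_iff_of_nonneg hB.le).2 fun i => ?_
      have := hcoord ((ContinuousLinearMap.proj (R := ℝ) (φ := fun _ : Fin n => ℝ) i).comp
        (ContinuousLinearMap.fst ℝ (Fin n → ℝ) (Fin n → Fin n → ℝ)))
      refine le_trans (le_of_eq (congrArg abs this)) ?_
      refine le_trans ?_ (hβB i)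
      -- The integration by parts in space is available because `velDir` has no time component.
      have h := abs_setIntegral_pd_mul_le hO hO_bdd (contDiff_pd hψ (0, ζ)) (h3 i)
        (c i • ζ - ζ i • c) t hχ
      rwa [← velDir_eq] at h
    · refine (pi_norm_le_iff_of_nonneg hB.le).2 fun i => ?_
      refine (pi_norm_le_iff_of_nonneg hB.le).2 fun j => ?_
      have := hcoord ((ContinuousLinearMap.proj (R := ℝ) (φ := fun _ : Fin n => ℝ) j).comp
        ((ContinuousLinearMap.proj (R := ℝ) (φ := fun _ : Fin n => Fin n → ℝ) i).comp
          (ContinuousLinearMap.snd ℝ (Fin n → ℝ) (Fin n → Fin n → ℝ))))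
      refine le_trans (le_of_eq (congrArg abs this)) ?_
      refine le_trans ?_ (hβB i)
      have h := abs_setIntegral_pd_mul_le hO hO_bdd (contDiff_pd hψ (fluxDir d ζ j)) (h4 i j)
        (c i • ζ - ζ i • c) t hχ
      rwa [← velDir_eq] at h

end LocalizedWave

/-! ### Gauges: comparison with the norm and joint continuity. -/

namespace Body

variable {n : ℕ} {K K' : Body n} {ρ R : ℝ}

theorem convex_set (K : Body n) : Convex ℝ K.set := K.1.convex

theorem absorbent_set (K : Body n) : Absorbent ℝ K.set := absorbent_nhds_zero K.2

theorem j_nonneg (K : Body n) (x : E n) : 0 ≤ K.j x := gauge_nonneg x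

theorem j_add_le (K : Body n) (x y : E n) : K.j (x + y) ≤ K.j x + K.j y :=
  gauge_add_le K.convex_set K.absorbent_set x y

theorem j_le_norm_div (hρ : 0 < ρ) (h : Metric.closedBall 0 ρ ⊆ K.set) (x : E n) :
    K.j x ≤ ‖x‖ / ρ := by
  rw [← gauge_closedBall hρ.le]
  exact gauge_mono (absorbent_nhds_zero (Metric.closedBall_mem_nhds 0 hρ)) h x

theorem norm_div_le_j (hR : 0 ≤ R) (h : K.set ⊆ Metric.closedBall 0 R) (x : E n) :
    ‖x‖ / R ≤ K.j x := by
  rw [← gauge_closedBall hR]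
  exact gauge_mono K.absorbent_set h x

theorem closedBall_subset_of_lt_rmin (h : ρ < K.rmin) : Metric.closedBall 0 ρ ⊆ K.set := by
  obtain ⟨R, ⟨-, hR⟩, hlt⟩ := exists_lt_of_lt_csSup
    (s := {R : ℝ | 0 ≤ R ∧ Metric.closedBall 0 R ⊆ K.set})
    ⟨0, le_rfl, by simpa using mem_of_mem_nhds K.2⟩ h
  exact (Metric.closedBall_subset_closedBall hlt.le).trans hR

theorem subset_closedBall_of_rmax_lt (h : K.rmax < R) : K.set ⊆ Metric.closedBall 0 R := by
  have hne : {R : ℝ | 0 < R ∧ K.set ⊆ Metric.closedBall 0 R}.Nonempty := by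
    obtain ⟨R, hR⟩ := K.1.isCompact.isBounded.subset_closedBall (0 : E n)
    exact ⟨max R 1, by simp, hR.trans (Metric.closedBall_subset_closedBall (le_max_left _ _))⟩
  obtain ⟨R', ⟨-, hR'⟩, hlt⟩ := exists_lt_of_csInf_lt hne h
  exact hR'.trans (Metric.closedBall_subset_closedBall hlt.le)

theorem norm_div_le_j_of_rmax_le (hR : 0 < R) (h : K.rmax ≤ R) (x : E n) : ‖x‖ / R ≤ K.j x := by
  have hlim : Filter.Tendsto (fun R' : ℝ => ‖x‖ / R') (𝓝[>] R) (𝓝 (‖x‖ / R)) :=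
    (tendsto_const_nhds.div Filter.tendsto_id hR.ne').mono_left nhdsWithin_le_nhds
  refine le_of_tendsto hlim ?_
  filter_upwards [self_mem_nhdsWithin] with R' hR'
  exact norm_div_le_j (hR.trans hR').le (subset_closedBall_of_rmax_lt (h.trans_lt hR')) x

/-- A point of K lies within any δ > dist(K, K') of a point of K', and the gauge of K' is at most
norm/ρ on the difference; hence the gauge of K' is at most 1 + dist/ρ on K, and homogeneity extends
this to all x. -/
theorem j_le_mul_j (hρ : 0 < ρ) (h : Metric.closedBall 0 ρ ⊆ K'.set) (x : E n) :
    K'.j x ≤ (1 + dist K K' / ρ) * K.j x := by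
  have h1 : ∀ y ∈ K.set, K'.j y ≤ 1 + dist K K' / ρ := by
    intro y hy
    have hlim : Filter.Tendsto (fun δ : ℝ => 1 + δ / ρ) (𝓝[>] (dist K K'))
        (𝓝 (1 + dist K K' / ρ)) :=
      (tendsto_const_nhds.add (Filter.tendsto_id.div_const ρ)).mono_left nhdsWithin_le_nhds
    refine ge_of_tendsto hlim ?_
    filter_upwards [self_mem_nhdsWithin] with δ hδ
    obtain ⟨w, hw, hyw⟩ := Metric.exists_dist_lt_of_hausdorffDist_lt (s := K.set) (t := K'.set)
      hy hδ ConvexBody.hausdorffEDist_ne_top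
    calc K'.j y = K'.j (w + (y - w)) := by rw [add_sub_cancel]
      _ ≤ K'.j w + K'.j (y - w) := K'.j_add_le _ _
      _ ≤ 1 + ‖y - w‖ / ρ := add_le_add (gauge_le_one_of_mem hw) (j_le_norm_div hρ h _)
      _ ≤ 1 + δ / ρ := by
          rw [← dist_eq_norm]
          gcongr
  have hlim : Filter.Tendsto (fun s : ℝ => (1 + dist K K' / ρ) * s) (𝓝[>] (K.j x))
      (𝓝 ((1 + dist K K' / ρ) * K.j x)) :=
    (Filter.tendsto_id.const_mul _).mono_left nhdsWithin_le_nhds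
  refine ge_of_tendsto hlim ?_
  filter_upwards [self_mem_nhdsWithin] with s hs
  obtain ⟨b, hb, hbs, y, hy, rfl⟩ := exists_lt_of_gauge_lt K.absorbent_set hs
  have h2 : K'.j (b • y) = b * K'.j y := gauge_smul_of_nonneg hb.le y
  have h3 := h1 y hy
  have h0 := K'.j_nonneg y
  change K'.j (b • y) ≤ _
  rw [h2, mul_comm]
  have : 0 ≤ 1 + dist K K' / ρ := by positivity
  gcongr

theorem abs_j_sub_le (hρ : 0 < ρ) (h : Metric.closedBall 0 ρ ⊆ K.set)
    (h' : Metric.closedBall 0 ρ ⊆ K'.set) (x x' : E n) :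
    |K'.j x' - K.j x| ≤ dist K' K / ρ * (‖x‖ / ρ) + dist x' x / ρ := by
  have hd : (0 : ℝ) ≤ dist K' K / ρ := by positivity
  have h1 := j_le_mul_j (K := K) hρ h' x
  have h2 := j_le_mul_j (K := K') hρ h x
  have h3 := K'.j_add_le x (x' - x)
  have h4 := K'.j_add_le x' (x - x')
  have h5 := j_le_norm_div hρ h' (x' - x)
  have h6 := j_le_norm_div hρ h' (x - x')
  have h7 := mul_le_mul_of_nonneg_left (j_le_norm_div hρ h x) hd
  have h8 := mul_le_mul_of_nonneg_left (j_le_norm_div hρ h' x) hd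
  rw [← dist_eq_norm] at h5 h6
  rw [dist_comm] at h6
  rw [add_sub_cancel] at h3 h4
  rw [dist_comm] at h1
  rw [abs_le]
  constructor <;> linarith

theorem continuousOn_j (n : ℕ) (hρ : 0 < ρ) :
    ContinuousOn (fun q : Body n × E n => q.1.j q.2)
      ({K : Body n | Metric.closedBall 0 ρ ⊆ K.set} ×ˢ univ) := by
  rintro ⟨K, x⟩ ⟨hK, -⟩
  refine tendsto_iff_dist_tendsto_zero.2 ?_
  have hlim : Filter.Tendsto
      (fun q : Body n × E n => dist q.1 K / ρ * (‖x‖ / ρ) + dist q.2 x / ρ)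
      (𝓝[{K : Body n | Metric.closedBall 0 ρ ⊆ K.set} ×ˢ univ] (K, x)) (𝓝 0) := by
    have hc : Continuous
        (fun q : Body n × E n => dist q.1 K / ρ * (‖x‖ / ρ) + dist q.2 x / ρ) := by fun_prop
    have := hc.tendsto (K, x)
    simp only [dist_self, zero_div, zero_mul, add_zero] at this
    exact this.mono_left nhdsWithin_le_nhds
  refine squeeze_zero' (Filter.Eventually.of_forall fun _ => dist_nonneg) ?_ hlim
  filter_upwards [self_mem_nhdsWithin] with q hq
  exact abs_j_sub_le hρ hK hq.1 x q.2

end Body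

/-! ### Averages of rapid oscillations and the energy gain. -/

section Averaging

variable {n : ℕ}

theorem abs_integral_sub_le_of_eq_zero {Q : Set (E n)} (hQ : IsCompact Q) {f g : E n → ℝ}
    (hf : Continuous f) (hg : Continuous g) (hf0 : ∀ x ∉ Q, f x = 0) (hg0 : ∀ x ∉ Q, g x = 0)
    {ε : ℝ} (h : ∀ x ∈ Q, |f x - g x| ≤ ε) :
    |(∫ x, f x) - ∫ x, g x| ≤ ε * volume.real Q := by
  rw [← integral_sub (hf.integrable_of_hasCompactSupport (.intro hQ hf0))
    (hg.integrable_of_hasCompactSupport (.intro hQ hg0)),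
    ← setIntegral_eq_integral_of_forall_compl_eq_zero (s := Q)
      (fun x hx => by rw [hf0 x hx, hg0 x hx, sub_zero])]
  exact norm_setIntegral_le_of_norm_le_const (f := fun x => f x - g x) hQ.measure_lt_top h

theorem exists_pos_mul_le {ε : ℝ} (hε : 0 < ε) (a : ℝ) (ha : 0 ≤ a) : ∃ δ : ℝ, 0 < δ ∧ δ * a ≤ ε :=
  ⟨ε / (a + 1), by positivity, by
    rw [div_mul_eq_mul_div, div_le_iff₀ (by positivity)]
    nlinarith⟩

variable {ξ : ℝ × E n →L[ℝ] ℝ} {ζ : E n}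

open Filter in
/-- Shifting the phase of a rapid oscillation does not change its averages in the limit. -/
theorem eventually_abs_integral_shift_le (hξ : ξ (0, ζ) = 1) {S : Set (ℝ × E n)}
    (hS : IsCompact S) {g : (ℝ × E n) × ℝ → ℝ} (hg : Continuous g)
    (hg0 : ∀ p ∉ S, ∀ s, g (p, s) = 0) (α : ℝ) {ε : ℝ} (hε : 0 < ε) :
    ∀ᶠ N : ℝ in atTop, ∀ t : ℝ,
      |(∫ x, g ((t, x), Real.sin (N * ξ (t, x))))
        - ∫ x, g ((t, x), Real.sin (N * ξ (t, x) + α))| ≤ ε := by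
  -- Room for translations of length below 1, so that uniform continuity applies to both the point
  -- and its translate.
  set S' := Metric.cthickening 1 S
  have hS' : IsCompact S' := hS.cthickening
  set Q : Set (E n) := Prod.snd '' S'
  have hQ : IsCompact Q := hS'.image continuous_snd
  obtain ⟨ε', hε', hεQ⟩ := exists_pos_mul_le hε (volume.real Q) measureReal_nonneg
  have huc := (hS'.prod (isCompact_Icc (a := (-1 : ℝ)) (b := 1))).uniformContinuousOn_of_continuous
    hg.continuousOn
  obtain ⟨δ, hδ, hgδ⟩ := Metric.uniformContinuousOn_iff.1 huc ε' hε'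
  have hlim : Tendsto (fun N : ℝ => |α / N| * ‖ζ‖) atTop (𝓝 0) := by
    simpa using (tendsto_const_nhds.div_atTop tendsto_id (a := α)).abs.mul_const ‖ζ‖
  filter_upwards [hlim.eventually (gt_mem_nhds (lt_min one_pos hδ)), eventually_gt_atTop 0]
    with N hN hN0 t
  obtain ⟨hN1, hNδ⟩ := lt_min_iff.1 hN
  set h : E n := (α / N) • ζ
  have hh : ‖h‖ = |α / N| * ‖ζ‖ := by rw [norm_smul, Real.norm_eq_abs]
  have hphase : ∀ x, N * ξ (t, x + h) = N * ξ (t, x) + α := by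
    intro x
    have : ((t, x + h) : ℝ × E n) = (t, x) + (α / N) • (0, ζ) := by ext <;> simp [h]
    rw [this, map_add, map_smul, hξ, smul_eq_mul, mul_one]
    field_simp
  have hdist : ∀ x, dist ((t, x + h) : ℝ × E n) (t, x) = ‖h‖ := by
    intro x
    simp [Prod.dist_eq]
  rw [← integral_add_right_eq_self (fun x => g ((t, x), Real.sin (N * ξ (t, x)))) h]
  simp only [hphase]
  refine le_trans (abs_integral_sub_le_of_eq_zero hQ (ε := ε') ?_ ?_ ?_ ?_ ?_) hεQ
  · exact hg.comp (by fun_prop)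
  · exact hg.comp (by fun_prop)
  · intro x hx
    refine hg0 _ (fun hmem => hx ⟨(t, x), ?_, rfl⟩) _
    refine Metric.mem_cthickening_of_dist_le _ _ _ _ hmem ?_
    rw [dist_comm, hdist, hh]
    exact hN1.le
  · intro x hx
    exact hg0 _ (fun hmem => hx ⟨(t, x), Metric.self_subset_cthickening _ hmem, rfl⟩) _
  · intro x _
    by_cases h1 : (t, x + h) ∈ S ∨ (t, x) ∈ S
    · have h2 : (t, x + h) ∈ S' ∧ (t, x) ∈ S' := by
        rcases h1 with h1 | h1
        · refine ⟨Metric.self_subset_cthickening _ h1,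
            Metric.mem_cthickening_of_dist_le _ _ _ _ h1 ?_⟩
          rw [dist_comm, hdist, hh]
          exact hN1.le
        · refine ⟨Metric.mem_cthickening_of_dist_le _ _ _ _ h1 ?_,
            Metric.self_subset_cthickening _ h1⟩
          rw [hdist, hh]
          exact hN1.le
      have hs : Real.sin (N * ξ (t, x) + α) ∈ Icc (-1 : ℝ) 1 :=
        ⟨Real.neg_one_le_sin _, Real.sin_le_one _⟩
      refine (hgδ ((t, x + h), _) ⟨h2.1, hs⟩ ((t, x), _) ⟨h2.2, hs⟩ ?_).le
      rw [Prod.dist_eq, dist_self, hdist, max_eq_left (norm_nonneg _), hh]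
      exact hNδ
    · push Not at h1
      rw [hg0 _ h1.1, hg0 _ h1.2, sub_zero, abs_zero]
      exact hε'.le

open Filter in
/-- The energy gain of a localized plane wave for a uniformly midpoint convex density. -/
theorem exists_eventually_energy_ge (hξ : ξ (0, ζ) = 1) {φ : ℝ × E n → ℝ} (hφ : Continuous φ)
    (hφc : HasCompactSupport φ) (hφ1 : ∀ p, |φ p| ≤ 1) {G : (ℝ × E n) × E n → ℝ}
    (hG : Continuous G) (hG0 : ∀ p, G (p, 0) = 0) {κ : ℝ} (hκ : 0 ≤ κ)
    (hGκ : ∀ p ∈ tsupport φ, ∀ w, κ * ‖w‖ ^ 2 ≤ G (p, w) + G (p, -w)) (e : E n)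
    {ε : ℝ} (hε : 0 < ε) :
    ∃ ρ : ℝ, 0 < ρ ∧ ∀ᶠ N : ℝ in atTop, ∀ v : ℝ × E n → E n, Continuous v →
      (∀ p ∉ tsupport φ, v p = 0) →
      (∀ p, ‖v p - (φ p * Real.sin (N * ξ p)) • e‖ ≤ ρ) →
      ∀ t, κ / 4 * ‖e‖ ^ 2 * (∫ x, φ (t, x) ^ 2) - ε ≤ ∫ x, G ((t, x), v (t, x)) := by
  set S := tsupport φ
  have hS : IsCompact S := hφc
  have hφ0 : ∀ p ∉ S, φ p = 0 := fun p hp => image_eq_zero_of_notMem_tsupport hp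
  set Q : Set (E n) := Prod.snd '' S
  have hQ : IsCompact Q := hS.image continuous_snd
  have hQS : ∀ t, ∀ x ∉ Q, (t, x) ∉ S := fun t x hx hmem => hx ⟨(t, x), hmem, rfl⟩
  have hQφ : ∀ t, ∀ x ∉ Q, φ (t, x) = 0 := fun t x hx => hφ0 _ (hQS t x hx)
  obtain ⟨ε₁, hε₁, hε₁Q⟩ := exists_pos_mul_le (by positivity : 0 < ε / 3) (volume.real Q)
    measureReal_nonneg
  have huc := (hS.prod (isCompact_closedBall (0 : E n) (‖e‖ + 1))).uniformContinuousOn_of_continuous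
    hG.continuousOn
  obtain ⟨δ, hδ, hGδ⟩ := Metric.uniformContinuousOn_iff.1 huc ε₁ hε₁
  obtain ⟨ε₂, hε₂, hε₂κ⟩ := exists_pos_mul_le (by positivity : 0 < ε / 3) (κ / 4 * ‖e‖ ^ 2)
    (by positivity)
  -- The 1 keeps `v` in the ball of radius ‖e‖ + 1 where δ was chosen; δ/2 makes the closeness
  -- strict.
  refine ⟨min (δ / 2) 1, by positivity, ?_⟩
  -- Half a period: sin becomes -sin.
  have e1 := eventually_abs_integral_shift_le hξ hS
    (g := fun q => G (q.1, (φ q.1 * q.2) • e)) (by fun_prop)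
    (fun p hp s => by simp [hφ0 p hp, hG0]) Real.pi (by positivity : 0 < ε / 3)
  -- A quarter period: sin² becomes cos².
  have e2 := eventually_abs_integral_shift_le hξ hS
    (g := fun q => φ q.1 ^ 2 * q.2 ^ 2) (by fun_prop)
    (fun p hp s => by simp [hφ0 p hp]) (Real.pi / 2) hε₂
  filter_upwards [e1, e2] with N h1 h2 v hv hv0 hvρ t
  replace h1 := h1 t
  replace h2 := h2 t
  simp only [Real.sin_add_pi, Real.sin_add_pi_div_two] at h1 h2
  have hint : ∀ f : E n → ℝ, Continuous f → (∀ x ∉ Q, f x = 0) → Integrable f := fun f hf h0 =>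
    hf.integrable_of_hasCompactSupport (.intro hQ h0)
  have i1 := hint (fun x => G ((t, x), (φ (t, x) * Real.sin (N * ξ (t, x))) • e))
    (hG.comp (by fun_prop)) (fun x hx => by simp [hQφ t x hx, hG0])
  have i2 := hint (fun x => G ((t, x), (φ (t, x) * -Real.sin (N * ξ (t, x))) • e))
    (hG.comp (by fun_prop)) (fun x hx => by simp [hQφ t x hx, hG0])
  have i3 := hint (fun x => φ (t, x) ^ 2 * Real.sin (N * ξ (t, x)) ^ 2)
    (by fun_prop) (fun x hx => by simp [hQφ t x hx])
  have i4 := hint (fun x => φ (t, x) ^ 2 * Real.cos (N * ξ (t, x)) ^ 2)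
    (by fun_prop) (fun x hx => by simp [hQφ t x hx])
  have hsin : ∀ p, ‖(φ p * Real.sin (N * ξ p)) • e‖ ≤ ‖e‖ := by
    intro p
    rw [norm_smul, norm_mul]
    refine mul_le_of_le_one_left (norm_nonneg _) ?_
    exact mul_le_one₀ (hφ1 p) (norm_nonneg _) (Real.abs_sin_le_one _)
  have h3 : |(∫ x, G ((t, x), v (t, x)))
      - ∫ x, G ((t, x), (φ (t, x) * Real.sin (N * ξ (t, x))) • e)| ≤ ε / 3 := by
    refine (abs_integral_sub_le_of_eq_zero hQ (ε := ε₁) (f := fun x => G ((t, x), v (t, x)))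
      (hG.comp (by fun_prop)) (hG.comp (by fun_prop)) ?_ ?_ ?_).trans hε₁Q
    · intro x hx
      simp only [hv0 _ (hQS t x hx), hG0]
    · intro x hx
      simp [hQφ t x hx, hG0]
    · intro x _
      by_cases hx : (t, x) ∈ S
      · have hρ := hvρ (t, x)
        refine (hGδ ((t, x), _) ⟨hx, ?_⟩ ((t, x), _) ⟨hx, ?_⟩ ?_).le
        · rw [mem_closedBall_zero_iff]
          calc ‖v (t, x)‖ ≤ ‖(φ (t, x) * Real.sin (N * ξ (t, x))) • e‖
                + ‖v (t, x) - (φ (t, x) * Real.sin (N * ξ (t, x))) • e‖ := norm_le_insert' _ _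
            _ ≤ ‖e‖ + 1 := add_le_add (hsin _) (hρ.trans (min_le_right _ _))
        · rw [mem_closedBall_zero_iff]
          exact (hsin _).trans (by linarith)
        · rw [Prod.dist_eq, dist_self, max_eq_right dist_nonneg, dist_eq_norm]
          exact (hρ.trans (min_le_left _ _)).trans_lt (by linarith)
      · simpa [hv0 _ hx, hφ0 _ hx, hG0] using hε₁.le
  have h4 : κ * ‖e‖ ^ 2 * (∫ x, φ (t, x) ^ 2 * Real.sin (N * ξ (t, x)) ^ 2)
      ≤ (∫ x, G ((t, x), (φ (t, x) * Real.sin (N * ξ (t, x))) • e))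
        + ∫ x, G ((t, x), (φ (t, x) * -Real.sin (N * ξ (t, x))) • e) := by
    rw [← integral_add i1 i2, ← integral_const_mul]
    refine integral_mono (i3.const_mul _) (i1.add i2) fun x => ?_
    by_cases hx : (t, x) ∈ S
    · have := hGκ _ hx ((φ (t, x) * Real.sin (N * ξ (t, x))) • e)
      rw [← neg_smul, ← mul_neg, norm_smul, mul_pow, Real.norm_eq_abs, sq_abs, mul_pow] at this
      linarith
    · simp [hφ0 _ hx, hG0]
  have h5 : (∫ x, φ (t, x) ^ 2 * Real.sin (N * ξ (t, x)) ^ 2)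
      + (∫ x, φ (t, x) ^ 2 * Real.cos (N * ξ (t, x)) ^ 2) = ∫ x, φ (t, x) ^ 2 := by
    rw [← integral_add i3 i4]
    refine integral_congr_ae (Eventually.of_forall fun x => ?_)
    simp only
    rw [← mul_add, Real.sin_sq_add_cos_sq, mul_one]
  set I1 := ∫ x, φ (t, x) ^ 2 * Real.sin (N * ξ (t, x)) ^ 2
  set I2 := ∫ x, φ (t, x) ^ 2
  have h6 : I2 / 2 - ε₂ / 2 ≤ I1 := by
    have := (abs_le.1 h2).1
    linarith
  have h7 : κ * ‖e‖ ^ 2 * (I2 / 2 - ε₂ / 2) ≤ κ * ‖e‖ ^ 2 * I1 :=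
    mul_le_mul_of_nonneg_left h6 (by positivity)
  have h8 := (abs_le.1 h1).1
  have h9 := (abs_le.1 h3).1
  linarith

end Averaging

/-! ### Choice of the phase, of the admissible error and of the cutoff. -/

theorem exists_ne_zero_inner_eq_zero {n : ℕ} (hn : 2 ≤ n) (w : E n) :
    ∃ y : E n, y ≠ 0 ∧ inner ℝ y w = 0 := by
  have hne : (Submodule.span ℝ {w})ᗮ ≠ ⊥ := by
    rw [Ne, Submodule.orthogonal_eq_bot_iff]
    intro h
    have h1 := finrank_span_le_card (R := ℝ) ({w} : Set (E n))
    rw [h, finrank_top, finrank_euclideanSpace_fin] at h1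
    simp at h1
    omega
  obtain ⟨y, hy, hy0⟩ := Submodule.exists_mem_ne_zero_of_ne_bot hne
  exact ⟨y, hy0, by
    rw [real_inner_comm]
    exact Submodule.mem_orthogonal_singleton_iff_inner_right.1 hy⟩

/-- A phase that is constant along `(b - a, 0)` and `(b + a, 2)` and not constant in space. -/
theorem exists_phase {n : ℕ} (hn : 2 ≤ n) (a b : E n) :
    ∃ (ξ : ℝ × E n →L[ℝ] ℝ) (ζ : E n), ξ (0, ζ) = 1 ∧ (∀ t : ℝ, ξ (0, t • (b - a)) = 0) ∧
      ξ (2, b + a) = 0 := by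
  obtain ⟨y, hy0, hy⟩ := exists_ne_zero_inner_eq_zero hn (b - a)
  -- The phase is ⟨y, x - t a⟩; on `(2, b + a)` it equals ⟨y, b - a⟩ = 0.
  refine ⟨(-inner ℝ y a) • ContinuousLinearMap.fst ℝ ℝ (E n)
    + (innerSL ℝ y).comp (ContinuousLinearMap.snd ℝ ℝ (E n)), (‖y‖ ^ 2)⁻¹ • y, ?_, ?_, ?_⟩
  · have : ‖y‖ ^ 2 ≠ 0 := by positivity
    simp [this]
  · intro t
    simp [hy]
  · rw [inner_sub_right] at hy
    simp [inner_add_right]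
    linarith

theorem exists_ball_subset_of_mem_nhdsSet_segment {W : Type*} [NormedAddCommGroup W]
    [NormedSpace ℝ W] {l : W} {V : Set W} (hV : V ∈ 𝓝ˢ (segment ℝ (-l) l)) :
    ∃ ε : ℝ, 0 < ε ∧ ∀ s : ℝ, |s| ≤ 1 → ∀ y, ‖y - s • l‖ ≤ ε → y ∈ V := by
  have hcomp : IsCompact (segment ℝ (-l) l) := by
    rw [segment_eq_image]
    exact isCompact_Icc.image (by fun_prop)
  obtain ⟨U, hU, hlU, hUV⟩ := mem_nhdsSet_iff_exists.1 hV
  obtain ⟨ε, hε, h⟩ := hcomp.exists_cthickening_subset_open hU hlU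
  refine ⟨ε, hε, fun s hs y hy => hUV (h ?_)⟩
  refine Metric.mem_cthickening_of_dist_le y (s • l) _ _ ?_ (by rwa [dist_eq_norm])
  obtain ⟨hs1, hs2⟩ := abs_le.1 hs
  refine ⟨(1 - s) / 2, (1 + s) / 2, by linarith, by linarith, by ring, ?_⟩
  rw [smul_neg, ← neg_smul, ← add_smul]
  congr 1
  ring

theorem exists_cutoff {X : Type*} [NormedAddCommGroup X] [NormedSpace ℝ X]
    [FiniteDimensional ℝ X] {C U : Set X} (hC : IsCompact C) (hU : IsOpen U) (hCU : C ⊆ U) :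
    ∃ φ : X → ℝ, ContDiff ℝ ∞ φ ∧ HasCompactSupport φ ∧ tsupport φ ⊆ U ∧ (∀ p ∈ C, φ p = 1) ∧
      ∀ p, |φ p| ≤ 1 := by
  obtain ⟨C', hC', hCC', hC'U⟩ := exists_compact_between hC hU hCU
  obtain ⟨φ, h1, h0, hφ⟩ := exists_contMDiffMap_one_nhds_of_subset_interior
    (modelWithCornersSelf ℝ X) (n := ⊤) hC.isClosed hCC'
  have hsupp : tsupport φ ⊆ C' := closure_minimal
    (fun p hp => by_contra fun h => hp (h0 p h)) hC'.isClosed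
  refine ⟨φ, φ.contMDiff.contDiff, hC'.of_isClosed_subset isClosed_closure hsupp,
    hsupp.trans hC'U, fun p hp => h1.self_of_nhdsSet p hp, fun p => ?_⟩
  rw [abs_of_nonneg (hφ p).1]
  exact (hφ p).2

/-! ### The energy density and its uniform convexity. -/

section Density

variable {n : ℕ} {D : Set (ℝ × E n)} {K : ℝ × E n → Body n} {u : ℝ × E n → E n} {c₀ r₀ R₀ : ℝ}

theorem continuousOn_density (hK : ContinuousOn K D) (hu : ContinuousOn u D) (hr₀ : 0 < r₀)
    (hmin : ∀ p ∈ D, r₀ ≤ (K p).rmin) :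
    ContinuousOn (fun q : (ℝ × E n) × E n => (K q.1).j (u q.1 + q.2) ^ 2) (D ×ˢ univ) := by
  refine ContinuousOn.pow ?_ 2
  refine (Body.continuousOn_j n (half_pos hr₀)).comp
    (f := fun q : (ℝ × E n) × E n => (K q.1, u q.1 + q.2)) ?_ ?_
  · have hfst : ContinuousOn (fun q : (ℝ × E n) × E n => q.1) (D ×ˢ univ) :=
      continuous_fst.continuousOn
    have hmaps : MapsTo (fun q : (ℝ × E n) × E n => q.1) (D ×ˢ univ) D := fun q hq => hq.1
    exact (hK.comp hfst hmaps).prodMk ((hu.comp hfst hmaps).add continuous_snd.continuousOn)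
  · intro q hq
    exact ⟨Body.closedBall_subset_of_lt_rmin ((half_lt_self hr₀).trans_le (hmin _ hq.1)), trivial⟩

/-- A continuous extension of the increment of the density `j_K (u + ·)²`. -/
theorem exists_density_extension (hD : IsClosed D) (hK : ContinuousOn K D)
    (hu : ContinuousOn u D) (hr₀ : 0 < r₀) (hmin : ∀ p ∈ D, r₀ ≤ (K p).rmin) :
    ∃ G : (ℝ × E n) × E n → ℝ, Continuous G ∧ (∀ p, G (p, 0) = 0) ∧
      ∀ p ∈ D, ∀ w, G (p, w) = (K p).j (u p + w) ^ 2 - (K p).j (u p) ^ 2 := by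
  obtain ⟨A, hA⟩ := ContinuousMap.exists_restrict_eq (hD.prod isClosed_univ)
    ⟨_, (continuousOn_density hK hu hr₀ hmin).domRestrict⟩
  have hA' : ∀ p ∈ D, ∀ w, A (p, w) = (K p).j (u p + w) ^ 2 := fun p hp w =>
    congrArg (fun f : C((D ×ˢ univ : Set ((ℝ × E n) × E n)), ℝ) => f ⟨(p, w), hp, trivial⟩) hA
  -- Subtracting the value at w = 0 of the Tietze extension itself makes `G` vanish at w = 0 even
  -- outside `D`, so integrals over all space see only the support of the wave.
  refine ⟨fun q => A q - A (q.1, 0), by fun_prop, fun p => sub_self _, fun p hp w => ?_⟩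
  simp only [hA' p hp, add_zero]

theorem density_add_density_ge {B : Body n} (hc₀ : 0 < c₀) (hR₀ : 0 < R₀) (hB : B.UnifConvex c₀)
    (hmax : B.rmax ≤ R₀) (x w : E n) :
    c₀ / R₀ ^ 2 * ‖w‖ ^ 2
      ≤ (B.j (x + w) ^ 2 - B.j x ^ 2) + (B.j (x + -w) ^ 2 - B.j x ^ 2) := by
  have h1 := hB x w
  have h2 : (‖w‖ / R₀) ^ 2 ≤ B.j w ^ 2 :=
    pow_le_pow_left₀ (by positivity) (Body.norm_div_le_j_of_rmax_le hR₀ hmax w) 2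
  have h3 : c₀ / R₀ ^ 2 * ‖w‖ ^ 2 = c₀ * (‖w‖ / R₀) ^ 2 := by ring
  rw [h3, ← sub_eq_add_neg]
  nlinarith

end Density

theorem isLinearSubsolution_zero (n : ℕ) : IsLinearSubsolution (fun _ : ℝ × E n => (0 : State n)) := by
  intro p
  simp [dt, dx]

theorem integrableOn_of_continuousOn_closure {n : ℕ} {O : Set (E n)}
    (hO_bdd : Bornology.IsBounded O) {f : E n → ℝ} (hf : ContinuousOn f (closure O)) :
    IntegrableOn f O :=
  (hf.integrableOn_compact hO_bdd.isCompact_closure).mono_set subset_closure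

end EulerSub

end

/-! ### Proof of the main theorem. -/

open EulerSub in
theorem mainTheorem5 (n : ℕ) (hn : 2 ≤ n)
    (O : Set (EulerSub.E n)) (hO : IsOpen O) (hO_bdd : Bornology.IsBounded O) (hO_ne : O.Nonempty)
    (t₀ t₁ : ℝ)
    (𝒦 : EulerSub.Body n) (z₀ : EulerSub.State n) (r : ℝ) (hr : 0 < r)
    (l : EulerSub.State n) (hl : l ∈ EulerSub.Lam 𝒦 z₀ r)
    (V : Set (EulerSub.State n)) (hV : V ∈ 𝓝ˢ (segment ℝ (-l) l))
    (O' : Set (EulerSub.E n)) (hO' : IsOpen O') (hO'_ne : O'.Nonempty) (hO'O : closure O' ⊆ O)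
    (θ : ℝ) (hθ : θ ∈ Ioo 0 ((t₁ - t₀) / 2))
    (K : ℝ × EulerSub.E n → EulerSub.Body n)
    (hK : ContinuousOn K (Icc t₀ t₁ ×ˢ closure O))
    (u : ℝ × EulerSub.E n → EulerSub.E n)
    (hu : ContinuousOn u (Icc t₀ t₁ ×ˢ closure O))
    (c₀ r₀ R₀ : ℝ) (hc₀ : 0 < c₀) (hr₀ : 0 < r₀) (hR₀ : r₀ < R₀)
    (hconv : ∀ p ∈ Icc t₀ t₁ ×ˢ closure O, (K p).UnifConvex c₀)
    (hmin : ∀ p ∈ Icc t₀ t₁ ×ˢ closure O, r₀ ≤ (K p).rmin)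
    (hmax : ∀ p ∈ Icc t₀ t₁ ×ˢ closure O, (K p).rmax ≤ R₀)
    (η : ℝ) (hη : 0 < η) :
    ∃ z : ℝ × EulerSub.E n → EulerSub.State n,
      (ContDiff ℝ ∞ z ∧ HasCompactSupport z ∧ tsupport z ⊆ Ioo t₀ t₁ ×ˢ O ∧ ∀ p, z p ∈ V) ∧
      EulerSub.IsLinearSubsolution z ∧
      (∀ t ∈ Icc (t₀ + θ) (t₁ - θ),
        IntegrableOn (fun x => (K (t, x)).j (u (t, x)) ^ 2) O ∧
        IntegrableOn (fun x => (K (t, x)).j (u (t, x) + (z (t, x)).1) ^ 2) O ∧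
        (∫ x in O, (K (t, x)).j (u (t, x)) ^ 2) + c₀ / (6 * R₀ ^ 2) * volume.real O' * ‖l.1‖ ^ 2
          ≤ ∫ x in O, (K (t, x)).j (u (t, x) + (z (t, x)).1) ^ 2) ∧
      (⨆ t ∈ Ioo t₀ t₁, EulerSub.hNegNormState O (fun x => z (t, x))) < ENNReal.ofReal η := by
  obtain ⟨hθ0, hθ1⟩ := hθ
  have hR₀' : 0 < R₀ := hr₀.trans hR₀
  have hcont := continuousOn_density hK hu hr₀ hmin
  have hint : ∀ t ∈ Icc (t₀ + θ) (t₁ - θ), ∀ w : E n → E n, Continuous w →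
      IntegrableOn (fun x => (K (t, x)).j (u (t, x) + w x) ^ 2) O := by
    intro t ht w hw
    refine integrableOn_of_continuousOn_closure hO_bdd ?_
    refine hcont.comp (f := fun x => ((t, x), w x)) (by fun_prop) fun x hx => ?_
    exact ⟨⟨⟨by linarith [ht.1], by linarith [ht.2]⟩, hx⟩, trivial⟩
  have hint0 : ∀ t ∈ Icc (t₀ + θ) (t₁ - θ),
      IntegrableOn (fun x => (K (t, x)).j (u (t, x)) ^ 2) O := by
    intro t ht
    simpa using hint t ht 0 continuous_zero
  obtain ⟨τ, -, a, -, b, -, -, rfl⟩ := hl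
  set l : State n := τ • ((b - a, F b - F a, (‖b‖ ^ 2 - ‖a‖ ^ 2) / n) : State n) with hl
  have hl1 : l.1 = τ • (b - a) := rfl
  have hlsym : l = symState n (fun i => l.1 i, fun i j => l.1 i * (b + a) j) :=
    smul_diff_eq_symState a b τ
  by_cases hl0 : l.1 = 0
  · have hlz : l = 0 := by
      have hw : ((fun i => l.1 i, fun i j => l.1 i * (b + a) j) :
          (Fin n → ℝ) × (Fin n → Fin n → ℝ)) = 0 := by
        refine Prod.ext ?_ ?_
        · ext i; simp [hl0]
        · ext i j; simp [hl0]
      rw [hlsym, hw, map_zero]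
    refine ⟨fun _ => 0, ⟨contDiff_const, HasCompactSupport.zero, ?_, fun _ => ?_⟩,
      isLinearSubsolution_zero n, fun t ht => ⟨hint0 t ht, ?_, ?_⟩, ?_⟩
    · simp [tsupport]
    · refine subset_of_mem_nhdsSet hV ?_
      simp [hlz]
    · simpa using hint0 t ht
    · simp [hl0]
    · simpa [hNegNormState, hNegNorm] using hη
  obtain ⟨ξ, ζ, hξζ, hξc, hξd⟩ := exists_phase hn a b
  obtain ⟨εV, hεV, hVmem⟩ := exists_ball_subset_of_mem_nhdsSet_segment (W := State n) hV
  obtain ⟨φ, hφ, hφc, hφU, hφ1, hφle⟩ := exists_cutoff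
    (C := Icc (t₀ + θ) (t₁ - θ) ×ˢ closure O') (U := Ioo t₀ t₁ ×ˢ O)
    (isCompact_Icc.prod (hO_bdd.subset (subset_closure.trans hO'O)).isCompact_closure)
    (isOpen_Ioo.prod hO)
    (prod_mono (fun t ht => ⟨by linarith [ht.1], by linarith [ht.2]⟩) hO'O)
  have hUD : Ioo t₀ t₁ ×ˢ O ⊆ Icc t₀ t₁ ×ˢ closure O :=
    prod_mono Ioo_subset_Icc_self subset_closure
  obtain ⟨G, hG, hG0, hGeq⟩ := exists_density_extension
    (isClosed_Icc.prod isClosed_closure) hK hu hr₀ hmin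
  have hO'fin : volume O' ≠ ⊤ :=
    (hO_bdd.subset (subset_closure.trans hO'O)).measure_lt_top.ne
  have hvolO' : 0 < volume.real O' :=
    ENNReal.toReal_pos (hO'.measure_pos volume hO'_ne).ne' hO'fin
  have hnorm : 0 < ‖l.1‖ := norm_pos_iff.2 hl0
  set κ := c₀ / R₀ ^ 2 with hκ
  have hκ0 : 0 < κ := by positivity
  have hGκ : ∀ p ∈ tsupport φ, ∀ w, κ * ‖w‖ ^ 2 ≤ G (p, w) + G (p, -w) := by
    intro p hp w
    have hpD := hUD (hφU hp)
    rw [hGeq p hpD, hGeq p hpD]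
    exact density_add_density_ge hc₀ hR₀' (hconv p hpD) (hmax p hpD) _ _
  -- The tolerance is κ/12 because 1/4 - 1/12 = 1/6.
  obtain ⟨ρ, hρ, henergy⟩ := exists_eventually_energy_ge hξζ hφ.continuous hφc hφle hG hG0
    hκ0.le hGκ l.1 (by positivity : 0 < κ / 12 * ‖l.1‖ ^ 2 * volume.real O')
  -- `εV` keeps z in `V`, `ρ` is the closeness needed for the energy, and η/2 leaves the supremum
  -- over time strictly below η.
  have hε : 0 < min (min εV ρ) (η / 2) := by positivity
  obtain ⟨N, hN, z, hz, hzφ, hzsub, hzapprox, hzneg⟩ := (henergy.and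
    (eventually_exists_localized_wave hO hO_bdd hξζ (hξc τ) hξd hφ hφc hε)).exists
  rw [← hl1, ← hlsym] at hzapprox
  have hz0 : ∀ p ∉ tsupport φ, z p = 0 := fun p hp =>
    image_eq_zero_of_notMem_tsupport fun h => hp (hzφ h)
  have hzcont : Continuous fun p => (z p).1 := hz.continuous.fst
  refine ⟨z, ⟨hz, hφc.of_isClosed_subset isClosed_closure hzφ, hzφ.trans hφU, fun p => ?_⟩,
    hzsub, fun t ht => ⟨hint0 t ht, ?_, ?_⟩, ?_⟩
  · refine hVmem (φ p * Real.sin (N * ξ p)) ?_ _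
      ((hzapprox p).trans ((min_le_left _ _).trans (min_le_left _ _)))
    rw [abs_mul]
    exact mul_le_one₀ (hφle p) (abs_nonneg _) (Real.abs_sin_le_one _)
  · exact hint t ht _ (hzcont.comp (by fun_prop))
  · have hintz := hint t ht (fun x => (z (t, x)).1) (hzcont.comp (by fun_prop))
    have ht' : t ∈ Ioo t₀ t₁ := ⟨by linarith [ht.1], by linarith [ht.2]⟩
    have h1 := hN (fun p => (z p).1) hzcont (fun p hp => by rw [hz0 p hp]; rfl) (fun p =>
      (norm_fst_le (z p - (φ p * Real.sin (N * ξ p)) • l)).trans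
        ((hzapprox p).trans ((min_le_left _ _).trans (min_le_right _ _)))) t
    have h2 : ∫ x, G ((t, x), (z (t, x)).1)
        = (∫ x in O, (K (t, x)).j (u (t, x) + (z (t, x)).1) ^ 2)
          - ∫ x in O, (K (t, x)).j (u (t, x)) ^ 2 := by
      rw [← integral_sub hintz (hint0 t ht), ← setIntegral_eq_integral_of_forall_compl_eq_zero
        (s := O) (f := fun x => G ((t, x), (z (t, x)).1))]
      · refine setIntegral_congr_fun hO.measurableSet fun x hx => ?_
        exact hGeq _ (hUD ⟨ht', hx⟩) _
      · intro x hx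
        have : z (t, x) = 0 := hz0 _ fun h => hx (hφU h).2
        simp only [this, Prod.fst_zero, hG0]
    have h3 : volume.real O' ≤ ∫ x, φ (t, x) ^ 2 := by
      have hφt : Integrable fun x => φ (t, x) ^ 2 := by
        refine Continuous.integrable_of_hasCompactSupport
          ((hφ.continuous.comp (by fun_prop)).pow 2)
          (.intro (hφc.isCompact.image continuous_snd) fun x hx => ?_)
        have : φ (t, x) = 0 := image_eq_zero_of_notMem_tsupport fun h => hx ⟨_, h, rfl⟩
        simp [this]
      calc volume.real O' = ∫ x in O', φ (t, x) ^ 2 := by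
            rw [setIntegral_congr_fun (g := fun _ => (1 : ℝ)) hO'.measurableSet fun x hx => by
              simp only [hφ1 (t, x) ⟨ht, subset_closure hx⟩, one_pow]]
            simp
        _ ≤ ∫ x, φ (t, x) ^ 2 :=
            setIntegral_le_integral hφt (Filter.Eventually.of_forall fun x => sq_nonneg _)
    have h4 := mul_le_mul_of_nonneg_left h3 (by positivity : 0 ≤ κ / 4 * ‖l.1‖ ^ 2)
    have h5 : c₀ / (6 * R₀ ^ 2) * volume.real O' * ‖l.1‖ ^ 2
        = κ / 6 * ‖l.1‖ ^ 2 * volume.real O' := by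
      rw [hκ]
      field_simp
    rw [h5]
    linarith
  · refine lt_of_le_of_lt (iSup₂_le fun t _ => (hzneg t).trans
      (ENNReal.ofReal_le_ofReal (min_le_right _ _))) ?_
    exact (ENNReal.ofReal_lt_ofReal_iff hη).2 (half_lt_self hη)
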